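/- **Setting.** Let $Q\in\mathbb R^{n\times n}$, $R\in\mathbb R^{m\times m}$ be symmetric positive definite, $\delta,x_0\in\mathbb R^n$, and let $w_0,w_1,\dots$ be i.i.d. $\mathcal N(0,W)$ vectors with $W\succ0$. Let $X_0,X_1\in\mathbb R^{n\times T}$, $U_0\in\mathbb R^{m\times T}$ be data such that $D_0=\begin{bmatrix}U_0\\X_0\end{bmatrix}$ has full row rank, let $\Lambda=\frac1TD_0D_0^\top$, $\overline X_0=\frac1TX_0D_0^\top$, $\overline U_0=\frac1TU_0D_0^\top$, $\overline X_1=\frac1TX_1D_0^\top$, and let $(\widehat A,\widehat B)$ be the least-squares fit of $X_1\approx \widehat AX_0+\widehat BU_0$. For a policy $\theta=[K\ \ l]\in\mathbb R^{m\times(n+1)}$ let $$J(\theta)=\limsup_{N\to\infty}\frac1N\,\mathbb E\Big[\sum_{t=0}^{N-1}(x_t-\delta)^\top Q(x_t-\delta)+u_t^\top Ru_t\Big],\qquad x_{t+1}=\widehat Ax_t+\widehat Bu_t+w_t,\quad u_t=Kx_t+l,$$ with initial state $x_0$, and let $J^*=\inf_\theta J(\theta)$. Let $\mathcal S_\theta$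 be the set of all $\theta=[K\ \ l]$ for which there are $V,h$ with $\begin{bmatrix}K\\I_n\end{bmatrix}=\Lambda V$, $\begin{bmatrix}l\\0\end{bmatrix}=\Lambda h$, $\overline X_0V=I_n$, $\overline X_0h=0$ and spectral radius $\rho(\overline X_1V)<1$; and let $\mathcal S_\theta(a)=\{\theta\in\mathcal S_\theta: J(\theta)\le a\}$. Put $M=\overline U_0(I-\overline X_0^\dagger\overline X_0)\overline U_0^\top$ with $\overline X_0^\dagger=\overline X_0^\top(\overline X_0\overline X_0^\top)^{-1}$. Gradients, inner products and norms of policies are the Euclidean (Frobenius) ones; $\|M\|$ is the spectral norm and $\underline\sigma(M)$ the minimal singular value of $M$. **Claim.** $J$ is finite and differentiable on $\mathcal S_\theta$. For every real $a\ge J^*$ there are constants $\lambda(a)>0$ and $\ell(a)>0$ such that (G) $J(\theta)-J^*\le\lambda(a)\,\|\nabla_\theta J(\theta)\|^2$ for all $\theta\in\mathcal S_\theta(a)$; (S) $J(\theta')\le J(\theta)+\langle\nabla_\theta J(\theta),\theta'-\theta\rangle+\frac{\ell(a)}2\|\theta'-\theta\|^2$ for all $\theta,\theta'\in\mathcal S_\theta(a)$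 such that $\theta+\phi(\theta'-\theta)\in\mathcal S_\theta(a)$ for all $\phi\in(0,1)$. Let $\theta^0\in\mathcal S_\theta$, and let $\lambda^0>0$, $\ell^0>0$ be any constants for which (G) and (S) hold with $a=J(\theta^0)$. Let $\eta\in(0,1/(\ell^0\|M\|)]$ and $\theta^{t+1}=\theta^t-\eta M\nabla_\theta J(\theta^t)$ for $t\in\mathbb N$. Then $\theta^t\in\mathcal S_\theta(J(\theta^0))$ for all $t\in\mathbb N$, and $$J(\theta^{t+1})-J^*\le(1-\nu)\,(J(\theta^t)-J^*)\quad\text{for all }t\in\mathbb N,\qquad \nu=\eta\Big(1-\frac{\ell^0\|M\|\eta}2\Big)\frac{\underline\sigma(M)}{\lambda^0}.$$ -/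

import Mathlib

open scoped ENNReal

namespace LQT

open MeasureTheory Filter Matrix

noncomputable section

/-- An affine feedback policy `θ = [K l]`, an `m × (n + 1)` real matrix. The matrices are given the
Euclidean (Frobenius) norm and inner product; the last column is indexed by `Sum.inr ()`. -/
abbrev Policy (n m : ℕ) : Type := EuclideanSpace ℝ (Fin m × (Fin n ⊕ Unit))

namespace Policy

variable {n m : ℕ}

/-- The policy as a matrix. -/
def toMatrix (θ : Policy n m) : Matrix (Fin m) (Fin n ⊕ Unit) ℝ := Matrix.of fun i j => θ (i, j)

/-- The policy with a given matrix. -/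
def ofMatrix (Θ : Matrix (Fin m) (Fin n ⊕ Unit) ℝ) : Policy n m :=
  WithLp.toLp 2 fun p => Θ p.1 p.2

/-- The feedback gain `K`. -/
def K (θ : Policy n m) : Matrix (Fin m) (Fin n) ℝ := Matrix.of fun i j => θ (i, Sum.inl j)

/-- The feedforward term `l`. -/
def l (θ : Policy n m) : Fin m → ℝ := fun i => θ (i, Sum.inr ())

end Policy

/-! ### The tracking cost -/

section Cost

variable {n m : ℕ}

/-- The state of `x_{t+1} = A x_t + B u_t + w_t`, `u_t = K x_t + l`, started at `x₀`, along a noise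
path `w`. -/
def state (A : Matrix (Fin n) (Fin n) ℝ) (B : Matrix (Fin n) (Fin m) ℝ) (x₀ : Fin n → ℝ)
    (θ : Policy n m) (w : ℕ → EuclideanSpace ℝ (Fin n)) : ℕ → Fin n → ℝ
  | 0 => x₀
  | t + 1 =>
      A *ᵥ state A B x₀ θ w t + B *ᵥ (θ.K *ᵥ state A B x₀ θ w t + θ.l) + (w t).ofLp

/-- The one-step cost `(x - δ)ᵀ Q (x - δ) + uᵀ R u`. -/
def stageCost (Q : Matrix (Fin n) (Fin n) ℝ) (R : Matrix (Fin m) (Fin m) ℝ) (δ x : Fin n → ℝ)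
    (u : Fin m → ℝ) : ℝ :=
  (x - δ) ⬝ᵥ (Q *ᵥ (x - δ)) + u ⬝ᵥ (R *ᵥ u)

variable {Ω : Type*} [MeasurableSpace Ω]

/-- The average cost `limsup_N (1/N) E[∑_{t<N} stage cost]` of a policy, as an extended nonnegative
number (it is infinite for policies that do not stabilize the system). -/
def averageCost (A : Matrix (Fin n) (Fin n) ℝ) (B : Matrix (Fin n) (Fin m) ℝ)
    (Q : Matrix (Fin n) (Fin n) ℝ) (R : Matrix (Fin m) (Fin m) ℝ) (δ x₀ : Fin n → ℝ)
    (P : Measure Ω) (w : ℕ → Ω → EuclideanSpace ℝ (Fin n)) (θ : Policy n m) : ℝ≥0∞ :=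
  limsup (fun N : ℕ =>
    (∫⁻ ω, ENNReal.ofReal (∑ t ∈ Finset.range N,
      stageCost Q R δ (state A B x₀ θ (fun s => w s ω) t)
        (θ.K *ᵥ state A B x₀ θ (fun s => w s ω) t + θ.l)) ∂P) / (N : ℝ≥0∞)) atTop

/-- The cost `J(θ)` as a real number. -/
def cost (A : Matrix (Fin n) (Fin n) ℝ) (B : Matrix (Fin n) (Fin m) ℝ)
    (Q : Matrix (Fin n) (Fin n) ℝ) (R : Matrix (Fin m) (Fin m) ℝ) (δ x₀ : Fin n → ℝ)
    (P : Measure Ω) (w : ℕ → Ω → EuclideanSpace ℝ (Fin n)) (θ : Policy n m) : ℝ :=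
  (averageCost A B Q R δ x₀ P w θ).toReal

/-- The optimal cost `J*`, the infimum of the average cost over all policies. -/
def optimalCost (A : Matrix (Fin n) (Fin n) ℝ) (B : Matrix (Fin n) (Fin m) ℝ)
    (Q : Matrix (Fin n) (Fin n) ℝ) (R : Matrix (Fin m) (Fin m) ℝ) (δ x₀ : Fin n → ℝ)
    (P : Measure Ω) (w : ℕ → Ω → EuclideanSpace ℝ (Fin n)) : ℝ :=
  (⨅ θ : Policy n m, averageCost A B Q R δ x₀ P w θ).toReal

end Cost

/-! ### The data and the covariance parameterization -/

section Data

variable {n m T : ℕ}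

/-- `D₀ = [U₀; X₀]`. -/
def D₀ (U₀ : Matrix (Fin m) (Fin T) ℝ) (X₀ : Matrix (Fin n) (Fin T) ℝ) :
    Matrix (Fin m ⊕ Fin n) (Fin T) ℝ :=
  Matrix.fromRows U₀ X₀

/-- The sample covariance `Λ = (1/T) D₀ D₀ᵀ`. -/
def Lam (U₀ : Matrix (Fin m) (Fin T) ℝ) (X₀ : Matrix (Fin n) (Fin T) ℝ) :
    Matrix (Fin m ⊕ Fin n) (Fin m ⊕ Fin n) ℝ :=
  (1 / (T : ℝ)) • (D₀ U₀ X₀ * (D₀ U₀ X₀)ᵀ)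

/-- `Y ↦ (1/T) Y D₀ᵀ`; applied to `X₀`, `U₀`, `X₁` it gives the matrices
`X̄₀`, `Ū₀`, `X̄₁`. -/
def bar (U₀ : Matrix (Fin m) (Fin T) ℝ) (X₀ : Matrix (Fin n) (Fin T) ℝ) {k : ℕ}
    (Y : Matrix (Fin k) (Fin T) ℝ) : Matrix (Fin k) (Fin m ⊕ Fin n) ℝ :=
  (1 / (T : ℝ)) • (Y * (D₀ U₀ X₀)ᵀ)

/-- `(A, B)` is a least-squares fit of `X₁ ≈ A X₀ + B U₀`. -/
def IsLeastSquares (U₀ : Matrix (Fin m) (Fin T) ℝ) (X₀ X₁ : Matrix (Fin n) (Fin T) ℝ)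
    (A : Matrix (Fin n) (Fin n) ℝ) (B : Matrix (Fin n) (Fin m) ℝ) : Prop :=
  ∀ (A' : Matrix (Fin n) (Fin n) ℝ) (B' : Matrix (Fin n) (Fin m) ℝ),
    ∑ i, ∑ j, ((X₁ - A * X₀ - B * U₀) i j) ^ 2 ≤ ∑ i, ∑ j, ((X₁ - A' * X₀ - B' * U₀) i j) ^ 2

/-- The spectral radius of a real square matrix (largest modulus of a complex eigenvalue). -/
def specRadius (F : Matrix (Fin n) (Fin n) ℝ) : ℝ≥0∞ :=
  spectralRadius ℂ (F.map Complex.ofReal)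

/-- The feasible set `𝒮` of the parameters `ξ = [V h]`. -/
def feasible (U₀ : Matrix (Fin m) (Fin T) ℝ) (X₀ X₁ : Matrix (Fin n) (Fin T) ℝ) :
    Set (Matrix (Fin m ⊕ Fin n) (Fin n) ℝ × (Fin m ⊕ Fin n → ℝ)) :=
  {ξ | bar U₀ X₀ X₀ * ξ.1 = 1 ∧ bar U₀ X₀ X₀ *ᵥ ξ.2 = 0 ∧ specRadius (bar U₀ X₀ X₁ * ξ.1) < 1}

/-- `ξ = [V h]` and `θ = [K l]` are related by `[K; I] = Λ V`, `[l; 0] = Λ h`. -/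
def Related (U₀ : Matrix (Fin m) (Fin T) ℝ) (X₀ : Matrix (Fin n) (Fin T) ℝ)
    (ξ : Matrix (Fin m ⊕ Fin n) (Fin n) ℝ × (Fin m ⊕ Fin n → ℝ)) (θ : Policy n m) : Prop :=
  Matrix.fromRows θ.K 1 = Lam U₀ X₀ * ξ.1 ∧ Sum.elim θ.l 0 = Lam U₀ X₀ *ᵥ ξ.2

/-- The set `𝒮_θ` of the policies that correspond to a feasible `ξ`. -/
def policySet (U₀ : Matrix (Fin m) (Fin T) ℝ) (X₀ X₁ : Matrix (Fin n) (Fin T) ℝ) :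
    Set (Policy n m) :=
  {θ | ∃ ξ ∈ feasible U₀ X₀ X₁, Related U₀ X₀ ξ θ}

/-- The sublevel set `𝒮_θ(a)` of a cost `J`. -/
def sublevel (U₀ : Matrix (Fin m) (Fin T) ℝ) (X₀ X₁ : Matrix (Fin n) (Fin T) ℝ)
    (J : Policy n m → ℝ) (a : ℝ) : Set (Policy n m) :=
  {θ | θ ∈ policySet U₀ X₀ X₁ ∧ J θ ≤ a}

/-- `M = Ū₀ (I - X̄₀† X̄₀) Ū₀ᵀ`, with the right inverse
`X̄₀† = X̄₀ᵀ (X̄₀ X̄₀ᵀ)⁻¹`. -/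
def precond (U₀ : Matrix (Fin m) (Fin T) ℝ) (X₀ : Matrix (Fin n) (Fin T) ℝ) :
    Matrix (Fin m) (Fin m) ℝ :=
  bar U₀ X₀ U₀ *
    (1 - (bar U₀ X₀ X₀)ᵀ * (bar U₀ X₀ X₀ * (bar U₀ X₀ X₀)ᵀ)⁻¹ * bar U₀ X₀ X₀) *
    (bar U₀ X₀ U₀)ᵀ

end Data

/-! ### Matrix norms and the regularity constants -/

section Constants

variable {n m : ℕ}

/-- The spectral norm (matrix 2-norm). -/
def opNorm (M : Matrix (Fin m) (Fin m) ℝ) : ℝ := ‖Matrix.toEuclideanCLM (𝕜 := ℝ) M‖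

/-- The minimal singular value of an `m × m` matrix (singular values are listed in decreasing order
from index `0`). -/
def minSingularValue (M : Matrix (Fin m) (Fin m) ℝ) : ℝ :=
  (Matrix.toEuclideanLin M).singularValues (m - 1)

/-- One step of the update `θ⁺ = θ - η M ∇J(θ)`. -/
def step (M : Matrix (Fin m) (Fin m) ℝ) (J : Policy n m → ℝ) (η : ℝ) (θ : Policy n m) :
    Policy n m :=
  θ - η • Policy.ofMatrix (M * (gradient J θ).toMatrix)

/-- `lam` is a gradient domination constant of `J` on `S`, relative to the value `Jstar`. -/
def GradientDominated (J : Policy n m → ℝ) (Jstar : ℝ) (S : Set (Policy n m)) (lam : ℝ) : Prop :=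
  ∀ θ ∈ S, J θ - Jstar ≤ lam * ‖gradient J θ‖ ^ 2

/-- `L` is a local smoothness constant of `J` on `S` (along segments contained in `S`). -/
def LocallySmooth (J : Policy n m → ℝ) (S : Set (Policy n m)) (L : ℝ) : Prop :=
  ∀ θ ∈ S, ∀ θ' ∈ S, (∀ φ ∈ Set.Ioo (0 : ℝ) 1, θ + φ • (θ' - θ) ∈ S) →
    J θ' ≤ J θ + inner ℝ (gradient J θ) (θ' - θ) + L * ‖θ' - θ‖ ^ 2 / 2

end Constants

end

end LQT

open scoped ENNReal Topology

namespace LQT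

open MeasureTheory Filter Matrix

noncomputable section

/-! ### Schur stability -/

section Schur

attribute [local instance] Matrix.linftyOpNormedRing Matrix.linftyOpNormedAlgebra

variable {n : ℕ}

lemma norm_map_ofReal (F : Matrix (Fin n) (Fin n) ℝ) : ‖F.map Complex.ofReal‖ = ‖F‖ := by
  simp [Matrix.linfty_opNorm_def]

lemma map_ofReal_pow (F : Matrix (Fin n) (Fin n) ℝ) (k : ℕ) :
    (F.map Complex.ofReal) ^ k = (F ^ k).map Complex.ofReal :=
  (Matrix.map_pow F Complex.ofRealHom k).symm

lemma tendsto_pow_of_specRadius_lt_one {F : Matrix (Fin n) (Fin n) ℝ} (h : specRadius F < 1) :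
    Tendsto (fun k => F ^ k) atTop (𝓝 0) := by
  have hG := spectrum.pow_nnnorm_pow_one_div_tendsto_nhds_spectralRadius (F.map Complex.ofReal)
  obtain ⟨r, hr, hr1⟩ := ENNReal.lt_iff_exists_nnreal_btwn.1 h
  have hr1' : r < 1 := by exact_mod_cast hr1
  have hev := hG.eventually_lt_const hr
  refine tendsto_zero_iff_norm_tendsto_zero.2 ?_
  refine squeeze_zero' (Eventually.of_forall fun _ => norm_nonneg _) ?_
    (tendsto_pow_atTop_nhds_zero_of_lt_one r.2 hr1')
  filter_upwards [hev, eventually_gt_atTop 0] with k hk hk0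
  have hk' : (0 : ℝ) < k := by exact_mod_cast hk0
  have h1 : (‖F.map Complex.ofReal ^ k‖₊ : ℝ≥0∞) < (r : ℝ≥0∞) ^ (k : ℝ) := by
    have := ENNReal.rpow_lt_rpow hk hk'
    rwa [← ENNReal.rpow_mul, one_div_mul_cancel hk'.ne', ENNReal.rpow_one] at this
  rw [ENNReal.rpow_natCast, ← ENNReal.coe_pow, ENNReal.coe_lt_coe] at h1
  have h2 : ‖F.map Complex.ofReal ^ k‖ < (r : ℝ) ^ k := by exact_mod_cast h1
  rw [map_ofReal_pow, norm_map_ofReal] at h2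
  exact h2.le

lemma exists_norm_pow_lt_one {F : Matrix (Fin n) (Fin n) ℝ}
    (h : Tendsto (fun k => F ^ k) atTop (𝓝 0)) : ∃ k : ℕ, ‖F ^ (k + 1)‖ < 1 := by
  have h1 := (tendsto_zero_iff_norm_tendsto_zero.1 h).eventually_lt_const one_pos
  obtain ⟨k, hk⟩ := ((tendsto_add_atTop_nat 1).eventually h1).exists
  exact ⟨k, hk⟩

lemma specRadius_lt_one_of_norm_pow_lt_one {F : Matrix (Fin n) (Fin n) ℝ} {k : ℕ}
    (h : ‖F ^ (k + 1)‖ < 1) : specRadius F < 1 := by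
  rcases isEmpty_or_nonempty (Fin n) with hn | hn
  · simp [specRadius, spectralRadius]
  · refine (spectrum.spectralRadius_le_pow_nnnorm_pow_one_div ℂ (F.map Complex.ofReal) k).trans_lt ?_
    have h1 : (‖F.map Complex.ofReal ^ (k + 1)‖₊ : ℝ≥0∞) < 1 := by
      rw [map_ofReal_pow]
      have : ‖(F ^ (k + 1)).map Complex.ofReal‖₊ < 1 := by
        rw [← NNReal.coe_lt_coe, coe_nnnorm, norm_map_ofReal]
        exact h
      exact_mod_cast this
    have hk : (0 : ℝ) < 1 / (k + 1) := by positivity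
    simpa using ENNReal.rpow_lt_rpow h1 hk

/-- A real square matrix has spectral radius below one iff its powers tend to zero. -/
lemma specRadius_lt_one_iff {F : Matrix (Fin n) (Fin n) ℝ} :
    specRadius F < 1 ↔ Tendsto (fun k => F ^ k) atTop (𝓝 0) :=
  ⟨tendsto_pow_of_specRadius_lt_one, fun h =>
    (exists_norm_pow_lt_one h).elim fun _ hk => specRadius_lt_one_of_norm_pow_lt_one hk⟩

lemma isOpen_setOf_schur :
    IsOpen {F : Matrix (Fin n) (Fin n) ℝ | Tendsto (fun k => F ^ k) atTop (𝓝 0)} := by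
  have : {F : Matrix (Fin n) (Fin n) ℝ | Tendsto (fun k => F ^ k) atTop (𝓝 0)} =
      ⋃ k : ℕ, {F | ‖F ^ (k + 1)‖ < 1} := by
    ext F
    simp only [Set.mem_ofPred_eq, Set.mem_iUnion]
    exact ⟨exists_norm_pow_lt_one, fun ⟨k, hk⟩ =>
      specRadius_lt_one_iff.1 (specRadius_lt_one_of_norm_pow_lt_one hk)⟩
  rw [this]
  exact isOpen_iUnion fun k => isOpen_lt (by fun_prop) (by fun_prop)

end Schur

/-! ### The system in homogeneous coordinates `z = (x, 1)` -/

section Homogeneous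

variable {n m : ℕ}

/-- Homogeneous coordinates of a state. -/
def hom (x : Fin n → ℝ) : Fin n ⊕ Unit → ℝ := Sum.elim x 1

/-- The closed-loop matrix in homogeneous coordinates. -/
def closedLoop (A : Matrix (Fin n) (Fin n) ℝ) (B : Matrix (Fin n) (Fin m) ℝ) (θ : Policy n m) :
    Matrix (Fin n ⊕ Unit) (Fin n ⊕ Unit) ℝ :=
  fromBlocks A 0 0 1 + fromRows B 0 * θ.toMatrix

/-- The matrix of `(x, c) ↦ x - c δ`. -/
def errorMat (δ : Fin n → ℝ) : Matrix (Fin n) (Fin n ⊕ Unit) ℝ :=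
  fromCols 1 (-replicateCol Unit δ)

/-- The matrix of the closed-loop stage cost in homogeneous coordinates. -/
def stageWeight (Q : Matrix (Fin n) (Fin n) ℝ) (R : Matrix (Fin m) (Fin m) ℝ) (δ : Fin n → ℝ)
    (θ : Policy n m) : Matrix (Fin n ⊕ Unit) (Fin n ⊕ Unit) ℝ :=
  (errorMat δ)ᵀ * Q * errorMat δ + θ.toMatrixᵀ * R * θ.toMatrix

/-- The noise covariance in homogeneous coordinates. -/
def noiseCov (W : Matrix (Fin n) (Fin n) ℝ) : Matrix (Fin n ⊕ Unit) (Fin n ⊕ Unit) ℝ :=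
  fromBlocks W 0 0 0

lemma toMatrix_eq_fromCols (θ : Policy n m) :
    θ.toMatrix = fromCols θ.K (replicateCol Unit θ.l) := by
  ext i (j | j) <;> rfl

lemma toMatrix_mulVec_hom (θ : Policy n m) (x : Fin n → ℝ) :
    θ.toMatrix *ᵥ hom x = θ.K *ᵥ x + θ.l := by
  rw [toMatrix_eq_fromCols]
  ext i
  simp [hom, Matrix.mulVec, dotProduct]

lemma errorMat_mulVec_hom (δ x : Fin n → ℝ) : errorMat δ *ᵥ hom x = x - δ := by
  ext i
  simp [errorMat, hom, Matrix.mulVec, dotProduct, Matrix.one_apply, sub_eq_add_neg]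

lemma closedLoop_eq_fromBlocks (A : Matrix (Fin n) (Fin n) ℝ) (B : Matrix (Fin n) (Fin m) ℝ)
    (θ : Policy n m) :
    closedLoop A B θ = fromBlocks (A + B * θ.K) (replicateCol Unit (B *ᵥ θ.l)) 0 1 := by
  rw [closedLoop, toMatrix_eq_fromCols, fromRows_mul_fromCols, fromBlocks_add]
  congr 1
  · simp [Matrix.replicateCol_mulVec]
  · simp
  · simp

lemma closedLoop_mulVec_hom (A : Matrix (Fin n) (Fin n) ℝ) (B : Matrix (Fin n) (Fin m) ℝ)
    (θ : Policy n m) (x : Fin n → ℝ) :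
    closedLoop A B θ *ᵥ hom x = hom (A *ᵥ x + B *ᵥ (θ.K *ᵥ x + θ.l)) := by
  rw [closedLoop, Matrix.add_mulVec, ← Matrix.mulVec_mulVec, toMatrix_mulVec_hom]
  ext (i | i)
  · simp [hom, Matrix.fromBlocks_mulVec, Matrix.fromRows_mulVec]
  · simp [hom, Matrix.fromBlocks_mulVec, Matrix.fromRows_mulVec]

lemma dotProduct_conj_mulVec {ι κ : Type*} [Fintype ι] [Fintype κ] (S : Matrix κ κ ℝ)
    (L : Matrix κ ι ℝ) (y : ι → ℝ) :
    y ⬝ᵥ ((Lᵀ * S * L) *ᵥ y) = (L *ᵥ y) ⬝ᵥ (S *ᵥ (L *ᵥ y)) := by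
  rw [Matrix.mul_assoc, ← Matrix.mulVec_mulVec, Matrix.dotProduct_mulVec, Matrix.vecMul_transpose,
    ← Matrix.mulVec_mulVec]

lemma stageCost_eq (Q : Matrix (Fin n) (Fin n) ℝ) (R : Matrix (Fin m) (Fin m) ℝ)
    (δ x : Fin n → ℝ) (θ : Policy n m) :
    stageCost Q R δ x (θ.K *ᵥ x + θ.l) = hom x ⬝ᵥ (stageWeight Q R δ θ *ᵥ hom x) := by
  rw [stageWeight, Matrix.add_mulVec, dotProduct_add, dotProduct_conj_mulVec,
    dotProduct_conj_mulVec, errorMat_mulVec_hom, toMatrix_mulVec_hom, stageCost]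

end Homogeneous

/-! ### Second moments of the closed loop -/

section Moments

variable {n m : ℕ} {Ω : Type*} [MeasurableSpace Ω] {P : Measure Ω}

/-- The matrix of mixed second moments of two random vectors. -/
def crossMoment {ι : Type*} (P : Measure Ω) (z v : Ω → ι → ℝ) : Matrix ι ι ℝ :=
  Matrix.of fun a b => ∫ ω, z ω a * v ω b ∂P

section CrossMoment

variable {ι : Type*} {z v y : Ω → ι → ℝ}

lemma crossMoment_transpose (z v : Ω → ι → ℝ) : (crossMoment P z v)ᵀ = crossMoment P v z := by
  ext a b
  simp [crossMoment, mul_comm]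

lemma crossMoment_add_left (hz : ∀ a, MemLp (fun ω => z ω a) 2 P)
    (hy : ∀ a, MemLp (fun ω => y ω a) 2 P) (hv : ∀ a, MemLp (fun ω => v ω a) 2 P) :
    crossMoment P (fun ω => z ω + y ω) v = crossMoment P z v + crossMoment P y v := by
  ext a b
  simp only [crossMoment, Matrix.of_apply, Matrix.add_apply, Pi.add_apply, add_mul]
  exact integral_add ((hz a).integrable_mul (hv b)) ((hy a).integrable_mul (hv b))

lemma memLp_mulVec [Fintype ι] (hz : ∀ a, MemLp (fun ω => z ω a) 2 P) (F : Matrix ι ι ℝ) (a : ι) :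
    MemLp (fun ω => (F *ᵥ z ω) a) 2 P :=
  memLp_finsetSum _ fun b _ => (hz b).const_mul (F a b)

lemma crossMoment_mulVec_left [Fintype ι] (hz : ∀ a, MemLp (fun ω => z ω a) 2 P)
    (hv : ∀ a, MemLp (fun ω => v ω a) 2 P) (F : Matrix ι ι ℝ) :
    crossMoment P (fun ω => F *ᵥ z ω) v = F * crossMoment P z v := by
  ext a b
  simp only [crossMoment, Matrix.of_apply, Matrix.mul_apply, Matrix.mulVec, dotProduct,
    Finset.sum_mul, mul_assoc]
  exact (integral_finsetSum _ fun c _ => ((hz c).integrable_mul (hv b)).const_mul (F a c)).trans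
    (Finset.sum_congr rfl fun c _ => integral_const_mul _ _)

lemma crossMoment_mulVec_add [Fintype ι] (hz : ∀ a, MemLp (fun ω => z ω a) 2 P)
    (hv : ∀ a, MemLp (fun ω => v ω a) 2 P) (hzv : crossMoment P z v = 0) (F : Matrix ι ι ℝ) :
    crossMoment P (fun ω => F *ᵥ z ω + v ω) (fun ω => F *ᵥ z ω + v ω) =
      F * crossMoment P z z * Fᵀ + crossMoment P v v := by
  have hF := memLp_mulVec hz F
  have hvz : crossMoment P v z = 0 := by rw [← crossMoment_transpose, hzv, transpose_zero]
  have hs : ∀ a, MemLp (fun ω => (F *ᵥ z ω + v ω) a) 2 P := fun a => (hF a).add (hv a)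
  have key : ∀ {y : Ω → ι → ℝ}, (∀ a, MemLp (fun ω => y ω a) 2 P) →
      crossMoment P y (fun ω => F *ᵥ z ω + v ω) =
        crossMoment P y z * Fᵀ + crossMoment P y v := fun hy => by
    rw [← crossMoment_transpose, crossMoment_add_left hF hv hy, crossMoment_mulVec_left hz hy,
      transpose_add, transpose_mul, crossMoment_transpose, crossMoment_transpose]
  rw [crossMoment_add_left hF hv hs, crossMoment_mulVec_left hz hs, key hz, key hv, hzv, hvz]
  simp [Matrix.mul_assoc]

lemma integrable_quadratic [Fintype ι] (hz : ∀ a, MemLp (fun ω => z ω a) 2 P)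
    (C : Matrix ι ι ℝ) : Integrable (fun ω => z ω ⬝ᵥ (C *ᵥ z ω)) P :=
  integrable_finsetSum _ fun a _ => (hz a).integrable_mul (memLp_mulVec hz C a)

lemma integral_quadratic [Fintype ι] (hz : ∀ a, MemLp (fun ω => z ω a) 2 P)
    (C : Matrix ι ι ℝ) : ∫ ω, z ω ⬝ᵥ (C *ᵥ z ω) ∂P = trace (C * crossMoment P z z) := by
  rw [← crossMoment_mulVec_left hz hz C]
  simp only [dotProduct, trace, diag, crossMoment, Matrix.of_apply]
  refine (integral_finsetSum _ fun a _ => (hz a).integrable_mul (memLp_mulVec hz C a)).trans ?_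
  simp only [Pi.mul_apply, mul_comm]

end CrossMoment

section Noise

variable {W : Matrix (Fin n) (Fin n) ℝ} {w : ℕ → Ω → EuclideanSpace ℝ (Fin n)}

lemma memLp_noise
    (hw : ∀ t, ProbabilityTheory.HasLaw (w t) (ProbabilityTheory.multivariateGaussian 0 W) P)
    (t : ℕ) (i : Fin n) : MemLp (fun ω => w t ω i) 2 P := by
  have h : MemLp (fun x : EuclideanSpace ℝ (Fin n) => x i) 2
      (ProbabilityTheory.multivariateGaussian 0 W) :=
    (EuclideanSpace.proj (𝕜 := ℝ) i).comp_memLp' ProbabilityTheory.IsGaussian.memLp_two_id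
  rw [← (hw t).map_eq] at h
  exact (memLp_map_measure_iff h.1 (hw t).aemeasurable).1 h

lemma integral_noise
    (hw : ∀ t, ProbabilityTheory.HasLaw (w t) (ProbabilityTheory.multivariateGaussian 0 W) P)
    (t : ℕ) (i : Fin n) : ∫ ω, w t ω i ∂P = 0 := by
  have h := (hw t).integral_comp (f := fun x : EuclideanSpace ℝ (Fin n) => x i)
    (by fun_prop)
  refine h.trans ?_
  have := (EuclideanSpace.proj (𝕜 := ℝ) i).integral_comp_comm
    (ProbabilityTheory.IsGaussian.integrable_id
      (μ := ProbabilityTheory.multivariateGaussian (0 : EuclideanSpace ℝ (Fin n)) W))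
  simpa using this

lemma integral_noise_mul_noise (hW : W.PosSemidef)
    (hw : ∀ t, ProbabilityTheory.HasLaw (w t) (ProbabilityTheory.multivariateGaussian 0 W) P)
    (t : ℕ) (i j : Fin n) : ∫ ω, w t ω i * w t ω j ∂P = W i j := by
  have h := (hw t).integral_comp (f := fun x : EuclideanSpace ℝ (Fin n) => x i * x j)
    (by fun_prop)
  refine h.trans ?_
  have hm : ∀ k : Fin n, ∫ x : EuclideanSpace ℝ (Fin n), x k
      ∂(ProbabilityTheory.multivariateGaussian 0 W) = 0 := fun k => by
    have := (EuclideanSpace.proj (𝕜 := ℝ) k).integral_comp_comm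
      (ProbabilityTheory.IsGaussian.integrable_id
        (μ := ProbabilityTheory.multivariateGaussian (0 : EuclideanSpace ℝ (Fin n)) W))
    simpa using this
  have := ProbabilityTheory.covariance_eval_multivariateGaussian (μ := 0) hW i j
  simpa [ProbabilityTheory.covariance, hm] using this

lemma integral_noise_mul_noise_of_ne
    (hw : ∀ t, ProbabilityTheory.HasLaw (w t) (ProbabilityTheory.multivariateGaussian 0 W) P)
    (hi : ProbabilityTheory.iIndepFun w P) {s t : ℕ} (hst : s ≠ t) (i j : Fin n) :
    ∫ ω, w s ω i * w t ω j ∂P = 0 := by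
  have h : ProbabilityTheory.IndepFun (fun ω => w s ω i) (fun ω => w t ω j) P :=
    (hi.indepFun hst).comp (φ := fun x : EuclideanSpace ℝ (Fin n) => x i)
      (ψ := fun x : EuclideanSpace ℝ (Fin n) => x j) (by fun_prop) (by fun_prop)
  rw [h.integral_fun_mul_eq_mul_integral (memLp_noise hw s i).1 (memLp_noise hw t j).1,
    integral_noise hw, zero_mul]

lemma memLp_homNoise
    (hw : ∀ t, ProbabilityTheory.HasLaw (w t) (ProbabilityTheory.multivariateGaussian 0 W) P)
    (t : ℕ) (a : Fin n ⊕ Unit) :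
    MemLp (fun ω => (Sum.elim (w t ω).ofLp 0 : Fin n ⊕ Unit → ℝ) a) 2 P := by
  rcases a with i | i
  · exact memLp_noise hw t i
  · exact MemLp.zero

end Noise

section State

variable [IsProbabilityMeasure P] {W : Matrix (Fin n) (Fin n) ℝ}
  {w : ℕ → Ω → EuclideanSpace ℝ (Fin n)}
  (A : Matrix (Fin n) (Fin n) ℝ) (B : Matrix (Fin n) (Fin m) ℝ) (x₀ : Fin n → ℝ)
  (θ : Policy n m)

lemma hom_state_succ (w : ℕ → EuclideanSpace ℝ (Fin n)) (t : ℕ) :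
    hom (state A B x₀ θ w (t + 1)) =
      closedLoop A B θ *ᵥ hom (state A B x₀ θ w t) + Sum.elim (w t).ofLp 0 := by
  rw [closedLoop_mulVec_hom, state]
  ext (i | i) <;> simp [hom]

lemma memLp_hom_state
    (hw : ∀ t, ProbabilityTheory.HasLaw (w t) (ProbabilityTheory.multivariateGaussian 0 W) P)
    (t : ℕ) : ∀ a, MemLp (fun ω => hom (state A B x₀ θ (fun s => w s ω) t) a) 2 P := by
  induction t with
  | zero => exact fun a => memLp_const (hom x₀ a)
  | succ t ih =>
    intro a
    simp only [hom_state_succ]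
    exact (memLp_mulVec ih (closedLoop A B θ) a).add (memLp_homNoise hw t a)

lemma crossMoment_hom_state_noise
    (hw : ∀ t, ProbabilityTheory.HasLaw (w t) (ProbabilityTheory.multivariateGaussian 0 W) P)
    (hi : ProbabilityTheory.iIndepFun w P) (t : ℕ) :
    ∀ r, t ≤ r → crossMoment P (fun ω => hom (state A B x₀ θ (fun s => w s ω) t))
      (fun ω => Sum.elim (w r ω).ofLp 0) = 0 := by
  induction t with
  | zero =>
    intro r _
    ext a (j | j)
    · simp [crossMoment, state, integral_const_mul, integral_noise hw]
    · simp [crossMoment]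
  | succ t ih =>
    intro r hr
    simp only [hom_state_succ]
    rw [crossMoment_add_left (memLp_mulVec (memLp_hom_state A B x₀ θ hw t) _)
      (memLp_homNoise hw t) (memLp_homNoise hw r),
      crossMoment_mulVec_left (memLp_hom_state A B x₀ θ hw t) (memLp_homNoise hw r),
      ih r (by omega), mul_zero, zero_add]
    ext (i | i) (j | j)
    · simpa [crossMoment] using integral_noise_mul_noise_of_ne hw hi (by omega : t ≠ r) i j
    all_goals simp [crossMoment]

/-- The second moments of the closed loop in homogeneous coordinates. -/
def stateMoment (P : Measure Ω) (w : ℕ → Ω → EuclideanSpace ℝ (Fin n)) (t : ℕ) :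
    Matrix (Fin n ⊕ Unit) (Fin n ⊕ Unit) ℝ :=
  crossMoment P (fun ω => hom (state A B x₀ θ (fun s => w s ω) t))
    (fun ω => hom (state A B x₀ θ (fun s => w s ω) t))

lemma stateMoment_zero : stateMoment A B x₀ θ P w 0 = vecMulVec (hom x₀) (hom x₀) := by
  ext a b
  simp [stateMoment, crossMoment, state, vecMulVec_apply]

lemma stateMoment_succ (hW : W.PosSemidef)
    (hw : ∀ t, ProbabilityTheory.HasLaw (w t) (ProbabilityTheory.multivariateGaussian 0 W) P)
    (hi : ProbabilityTheory.iIndepFun w P) (t : ℕ) :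
    stateMoment A B x₀ θ P w (t + 1) =
      closedLoop A B θ * stateMoment A B x₀ θ P w t * (closedLoop A B θ)ᵀ + noiseCov W := by
  have hV : crossMoment P (fun ω => (Sum.elim (w t ω).ofLp 0 : Fin n ⊕ Unit → ℝ))
      (fun ω => Sum.elim (w t ω).ofLp 0) = noiseCov W := by
    ext (i | i) (j | j)
    · simpa [crossMoment, noiseCov] using integral_noise_mul_noise hW hw t i j
    all_goals simp [crossMoment, noiseCov]
  rw [stateMoment, ← hV]
  simp only [hom_state_succ]
  exact crossMoment_mulVec_add (memLp_hom_state A B x₀ θ hw t) (memLp_homNoise hw t)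
    (crossMoment_hom_state_noise A B x₀ θ hw hi t t le_rfl) _

lemma stageCost_nonneg {Q : Matrix (Fin n) (Fin n) ℝ} {R : Matrix (Fin m) (Fin m) ℝ}
    (hQ : Q.PosSemidef) (hR : R.PosSemidef) (δ x : Fin n → ℝ) (u : Fin m → ℝ) :
    0 ≤ stageCost Q R δ x u := by
  have h1 := hQ.dotProduct_mulVec_nonneg (x - δ)
  have h2 := hR.dotProduct_mulVec_nonneg u
  simp only [star_trivial] at h1 h2
  exact add_nonneg h1 h2

/-- The average cost is the upper limit of the averages of the expected stage costs. -/
lemma averageCost_eq_limsup {Q : Matrix (Fin n) (Fin n) ℝ} {R : Matrix (Fin m) (Fin m) ℝ}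
    (hQ : Q.PosSemidef) (hR : R.PosSemidef) (δ : Fin n → ℝ)
    (hw : ∀ t, ProbabilityTheory.HasLaw (w t) (ProbabilityTheory.multivariateGaussian 0 W) P) :
    averageCost A B Q R δ x₀ P w θ = limsup (fun N : ℕ => ENNReal.ofReal
      (∑ t ∈ Finset.range N, trace (stageWeight Q R δ θ * stateMoment A B x₀ θ P w t)) /
        (N : ℝ≥0∞)) atTop := by
  rw [averageCost]
  congr 1
  ext N
  congr 1
  rw [← ofReal_integral_eq_lintegral_ofReal]
  · congr 1
    rw [integral_finsetSum]
    · refine Finset.sum_congr rfl fun t _ => ?_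
      simp only [stageCost_eq]
      exact integral_quadratic (memLp_hom_state A B x₀ θ hw t) _
    · intro t _
      simp only [stageCost_eq]
      exact integrable_quadratic (memLp_hom_state A B x₀ θ hw t) _
  · refine integrable_finsetSum _ fun t _ => ?_
    simp only [stageCost_eq]
    exact integrable_quadratic (memLp_hom_state A B x₀ θ hw t) _
  · exact Eventually.of_forall fun ω => Finset.sum_nonneg fun t _ => stageCost_nonneg hQ hR _ _ _

end State

end Moments

/-! ### Lyapunov equations with a marked eigenvalue one -/

section Lyapunov

variable {ι : Type*} [Fintype ι] [DecidableEq ι] {Φ : Matrix ι ι ℝ} {e : ι}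

/-- `Φ` preserves the coordinate `e`, and congruence by its powers kills the matrices whose `(e, e)`
entry vanishes. -/
structure Settles (Φ : Matrix ι ι ℝ) (e : ι) : Prop where
  row : Φ e = Pi.single e 1
  tendsto : ∀ X : Matrix ι ι ℝ, X e e = 0 →
    Tendsto (fun k => Φ ^ k * X * (Φ ^ k)ᵀ) atTop (𝓝 0)

/-- The map `X ↦ X - Φ X Φᵀ + X e e • E e e`. -/
def lyap (Φ : Matrix ι ι ℝ) (e : ι) : Matrix ι ι ℝ →ₗ[ℝ] Matrix ι ι ℝ where
  toFun X := X - Φ * X * Φᵀ + single e e (X e e)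
  map_add' X Y := by
    rw [mul_add, add_mul, Matrix.add_apply, single_add]
    abel
  map_smul' c X := by
    simp only [mul_smul_comm, smul_mul_assoc, Matrix.smul_apply, RingHom.id_apply, smul_add,
      smul_sub, smul_single]

lemma lyap_apply (Φ : Matrix ι ι ℝ) (e : ι) (X : Matrix ι ι ℝ) :
    lyap Φ e X = X - Φ * X * Φᵀ + single e e (X e e) := rfl

lemma conj_pow_succ (Φ X : Matrix ι ι ℝ) (k : ℕ) :
    Φ ^ (k + 1) * X * (Φ ^ (k + 1))ᵀ = Φ * (Φ ^ k * X * (Φ ^ k)ᵀ) * Φᵀ := by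
  rw [pow_succ', transpose_mul]
  simp only [Matrix.mul_assoc]

lemma eq_conj_pow {X : ℕ → Matrix ι ι ℝ} (h : ∀ k, X (k + 1) = Φ * X k * Φᵀ) (k : ℕ) :
    X k = Φ ^ k * X 0 * (Φ ^ k)ᵀ := by
  induction k with
  | zero => simp
  | succ k ih => rw [h, conj_pow_succ, ← ih]

/-- Iterating a Lyapunov equation. -/
lemma eq_conj_pow_add_sum {Z V : Matrix ι ι ℝ} (h : Z = Φ * Z * Φᵀ + V) (k : ℕ) :
    Z = Φ ^ k * Z * (Φ ^ k)ᵀ + ∑ i ∈ Finset.range k, Φ ^ i * V * (Φ ^ i)ᵀ := by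
  induction k with
  | zero => simp
  | succ k ih =>
    rw [Finset.sum_range_succ, pow_succ, transpose_mul]
    have : Φ ^ k * Φ * Z * (Φᵀ * (Φ ^ k)ᵀ) = Φ ^ k * (Z - V) * (Φ ^ k)ᵀ := by
      rw [sub_eq_iff_eq_add.2 h]
      simp only [Matrix.mul_assoc]
    rw [this, mul_sub, sub_mul]
    nth_rewrite 1 [ih]
    abel

namespace Settles

lemma conj_apply_self (h : Settles Φ e) (X : Matrix ι ι ℝ) : (Φ * X * Φᵀ) e e = X e e := by
  simp [Matrix.mul_apply, h.row, Pi.single_apply]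

lemma eq_zero_of_conj (h : Settles Φ e) {X : Matrix ι ι ℝ} (he : X e e = 0)
    (hX : X = Φ * X * Φᵀ) : X = 0 := by
  have h1 : ∀ k, X = Φ ^ k * X * (Φ ^ k)ᵀ := eq_conj_pow (X := fun _ => X) fun _ => hX
  have h2 := h.tendsto X he
  simp only [← h1] at h2
  exact tendsto_nhds_unique tendsto_const_nhds h2

lemma lyap_injective (h : Settles Φ e) : Function.Injective (lyap Φ e) := by
  rw [← LinearMap.ker_eq_bot, LinearMap.ker_eq_bot']
  intro X hX
  rw [lyap_apply] at hX
  have he : X e e = 0 := by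
    have := congrFun (congrFun hX e) e
    simpa [h.conj_apply_self] using this
  refine h.eq_zero_of_conj he ?_
  rw [he, single_zero, add_zero, sub_eq_zero] at hX
  exact hX

lemma lyap_surjective (h : Settles Φ e) : Function.Surjective (lyap Φ e) :=
  LinearMap.surjective_of_injective h.lyap_injective

lemma lyap_transpose (Φ X : Matrix ι ι ℝ) (e : ι) : (lyap Φ e X)ᵀ = lyap Φ e Xᵀ := by
  simp [lyap_apply, Matrix.mul_assoc]

lemma trace_mul_single (Y : Matrix ι ι ℝ) (c : ℝ) : trace (Y * single e e c) = Y e e * c := by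
  simp [Matrix.trace_mul_single]

/-- The operators `lyap` of `Φ` and `Φᵀ` are adjoint for the trace pairing. -/
lemma trace_mul_lyap (Φ X Y : Matrix ι ι ℝ) (e : ι) :
    trace (Y * lyap Φ e X) = trace (lyap Φᵀ e Y * X) := by
  rw [lyap_apply, lyap_apply, mul_add, add_mul, trace_add, trace_add, mul_sub, sub_mul, trace_sub,
    trace_sub, trace_mul_single, trace_mul_comm (single e e (Y e e)), trace_mul_single,
    transpose_transpose]
  have : trace (Y * (Φ * X * Φᵀ)) = trace (Φᵀ * Y * Φ * X) := by
    rw [← Matrix.mul_assoc, trace_mul_comm]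
    simp only [Matrix.mul_assoc]
  rw [this, mul_comm (X e e)]

lemma lyap_transpose_surjective (h : Settles Φ e) : Function.Surjective (lyap Φᵀ e) := by
  refine LinearMap.surjective_of_injective ?_
  rw [← LinearMap.ker_eq_bot, LinearMap.ker_eq_bot']
  intro Y hY
  obtain ⟨X, hX⟩ := h.lyap_surjective Yᵀ
  have h1 : trace (Y * Yᵀ) = 0 := by
    rw [← hX, trace_mul_lyap, hY, zero_mul, trace_zero]
  rw [← conjTranspose_eq_transpose_of_trivial] at h1
  exact trace_mul_conjTranspose_self_eq_zero_iff.1 h1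

/-- The average-cost Bellman equation has a symmetric solution. -/
lemma exists_bellman (h : Settles Φ e) {C : Matrix ι ι ℝ} (hC : Cᵀ = C) :
    ∃ (S : Matrix ι ι ℝ) (κ : ℝ), Sᵀ = S ∧ S + single e e κ = C + Φᵀ * S * Φ := by
  obtain ⟨S, hS⟩ := h.lyap_transpose_surjective C
  refine ⟨(1 / 2 : ℝ) • (S + Sᵀ), S e e, by simp [add_comm], ?_⟩
  have hS' : lyap Φᵀ e Sᵀ = C := by rw [← lyap_transpose, hS, hC]
  rw [lyap_apply, transpose_transpose] at hS hS'
  have h1 : S + single e e (S e e) = C + Φᵀ * S * Φ := by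
    rw [← hS]; abel
  have h2 : Sᵀ + single e e (S e e) = C + Φᵀ * Sᵀ * Φ := by
    rw [← hS', transpose_apply]; abel
  have h3 : (1 / 2 : ℝ) • ((S + single e e (S e e)) + (Sᵀ + single e e (S e e))) =
      (1 / 2 : ℝ) • ((C + Φᵀ * S * Φ) + (C + Φᵀ * Sᵀ * Φ)) := by rw [h1, h2]
  have h4 : ∀ a b c : Matrix ι ι ℝ, (1 / 2 : ℝ) • ((a + c) + (b + c)) =
      (1 / 2 : ℝ) • (a + b) + c := fun a b c => by module
  have h5 : ∀ a b c : Matrix ι ι ℝ, (1 / 2 : ℝ) • ((c + a) + (c + b)) =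
      c + (1 / 2 : ℝ) • (a + b) := fun a b c => by module
  rw [h4, h5] at h3
  rw [h3, mul_smul_comm, smul_mul_assoc, mul_add, add_mul]

end Settles

section Stationary

/-- The Lyapunov operator as a continuous linear map on functions of two indices. -/
def lyapFun (Φ : Matrix ι ι ℝ) (e : ι) : (ι → ι → ℝ) →L[ℝ] (ι → ι → ℝ) :=
  LinearMap.toContinuousLinearMap
    ((ofLinearEquiv ℝ).symm.toLinearMap ∘ₗ lyap Φ e ∘ₗ (ofLinearEquiv ℝ).toLinearMap)

lemma lyapFun_apply (Φ : Matrix ι ι ℝ) (e : ι) (X : ι → ι → ℝ) :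
    lyapFun Φ e X = of.symm (lyap Φ e (of X)) := rfl

/-- The solution of `Z = Φ Z Φᵀ + V` with `Z e e = 1`. -/
def stationary (Φ : Matrix ι ι ℝ) (e : ι) (V : Matrix ι ι ℝ) : Matrix ι ι ℝ :=
  of (ContinuousLinearMap.inverse (lyapFun Φ e) (of.symm (V + single e e 1)))

/-- The Lyapunov operator as a continuous linear equivalence. -/
def Settles.lyapEquiv (h : Settles Φ e) : (ι → ι → ℝ) ≃L[ℝ] (ι → ι → ℝ) :=
  ((ofLinearEquiv ℝ).trans ((LinearEquiv.ofBijective (lyap Φ e)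
    ⟨h.lyap_injective, h.lyap_surjective⟩).trans (ofLinearEquiv ℝ).symm)).toContinuousLinearEquiv

lemma Settles.coe_lyapEquiv (h : Settles Φ e) :
    (h.lyapEquiv : (ι → ι → ℝ) →L[ℝ] (ι → ι → ℝ)) = lyapFun Φ e := by
  ext X
  rfl

lemma Settles.lyap_stationary (h : Settles Φ e) (V : Matrix ι ι ℝ) :
    lyap Φ e (stationary Φ e V) = V + single e e 1 := by
  rw [stationary, ← h.coe_lyapEquiv, ContinuousLinearMap.inverse_equiv]
  exact h.lyapEquiv.apply_symm_apply (of.symm (V + single e e 1))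

lemma contDiffAt_stationary {E : Type*} [NormedAddCommGroup E] [NormedSpace ℝ E]
    {f : E → Matrix ι ι ℝ} {x : E} {k : WithTop ℕ∞} (hf : ∀ a b, ContDiff ℝ k fun y => f y a b)
    (h : Settles (f x) e) (V : Matrix ι ι ℝ) (a b : ι) :
    ContDiffAt ℝ k (fun y => stationary (f y) e V a b) x := by
  have h1 : ContDiff ℝ k fun y => lyapFun (f y) e := by
    rw [contDiff_clm_apply_iff]
    intro X
    rw [contDiff_pi]
    intro c
    rw [contDiff_pi]
    intro d
    simp only [lyapFun_apply, lyap_apply, of_symm_apply, Matrix.add_apply, Matrix.sub_apply,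
      Matrix.mul_apply, transpose_apply, of_apply]
    fun_prop
  have h2 : ContDiffAt ℝ k ContinuousLinearMap.inverse (lyapFun (f x) e) := by
    rw [← h.coe_lyapEquiv]
    exact contDiffAt_map_inverse _
  have h3 := (h2.comp x h1.contDiffAt).clm_apply
    (contDiffAt_const (c := of.symm (V + single e e 1)))
  exact contDiffAt_pi.1 (contDiffAt_pi.1 h3 a) b

end Stationary

namespace Settles

lemma stationary_apply_self (h : Settles Φ e) {V : Matrix ι ι ℝ} (hV : V e e = 0) :
    stationary Φ e V e e = 1 := by
  have := congrFun (congrFun (h.lyap_stationary V) e) e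
  simpa [lyap_apply, h.conj_apply_self, hV] using this

lemma stationary_eq (h : Settles Φ e) {V : Matrix ι ι ℝ} (hV : V e e = 0) :
    stationary Φ e V = Φ * stationary Φ e V * Φᵀ + V := by
  have := h.lyap_stationary V
  rw [lyap_apply, h.stationary_apply_self hV, add_left_inj, sub_eq_iff_eq_add'] at this
  exact this

/-- The solution of the Lyapunov recursion converges to the stationary solution. -/
lemma tendsto_stationary (h : Settles Φ e) {V : Matrix ι ι ℝ} (hV : V e e = 0)
    {Z : ℕ → Matrix ι ι ℝ} (h0 : Z 0 e e = 1) (hZ : ∀ k, Z (k + 1) = Φ * Z k * Φᵀ + V) :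
    Tendsto Z atTop (𝓝 (stationary Φ e V)) := by
  have h1 := eq_conj_pow (Φ := Φ) (X := fun k => Z k - stationary Φ e V) fun k => by
    rw [hZ, mul_sub, sub_mul]
    nth_rewrite 1 [h.stationary_eq hV]
    abel
  have h2 := h.tendsto (Z 0 - stationary Φ e V) (by simp [h0, h.stationary_apply_self hV])
  simp only [← h1] at h2
  simpa using h2.add_const (stationary Φ e V)

end Settles

end Lyapunov

/-! ### Positive semidefinite matrices -/

section PosSemidef

lemma transpose_eq_of_posSemidef {ι : Type*} {X : Matrix ι ι ℝ} (hX : X.PosSemidef) : Xᵀ = X := by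
  rw [← conjTranspose_eq_transpose_of_trivial]
  exact hX.1

variable {ι κ : Type*} [Fintype ι] [Fintype κ]

section
open scoped MatrixOrder Matrix.Norms.L2Operator

lemma exists_eq_transpose_mul_self [DecidableEq ι] {X : Matrix ι ι ℝ} (hX : X.PosSemidef) :
    ∃ C : Matrix ι ι ℝ, X = Cᵀ * C := by
  obtain ⟨C, hC⟩ := CStarAlgebra.nonneg_iff_eq_star_mul_self.1 hX.nonneg
  exact ⟨C, by rw [hC, star_eq_conjTranspose, conjTranspose_eq_transpose_of_trivial]⟩

end

lemma quadratic_nonneg {X : Matrix ι ι ℝ} (hX : X.PosSemidef) (y : ι → ℝ) :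
    0 ≤ y ⬝ᵥ (X *ᵥ y) := by
  simpa using hX.dotProduct_mulVec_nonneg y

lemma posSemidef_of_quadratic_nonneg {X : Matrix ι ι ℝ} (hX : Xᵀ = X)
    (h : ∀ y, 0 ≤ y ⬝ᵥ (X *ᵥ y)) : X.PosSemidef :=
  PosSemidef.of_dotProduct_mulVec_nonneg
    (by rw [IsHermitian, conjTranspose_eq_transpose_of_trivial, hX]) (by simpa using h)

lemma posSemidef_conj {X : Matrix ι ι ℝ} (hX : X.PosSemidef) (F : Matrix κ ι ℝ) :
    (F * X * Fᵀ).PosSemidef := by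
  simpa using hX.mul_mul_conjTranspose_same F

lemma posSemidef_conj' {X : Matrix ι ι ℝ} (hX : X.PosSemidef) (F : Matrix ι κ ℝ) :
    (Fᵀ * X * F).PosSemidef := by
  simpa using hX.conjTranspose_mul_mul_same F

lemma trace_mul_nonneg [DecidableEq ι] {X Y : Matrix ι ι ℝ} (hX : X.PosSemidef)
    (hY : Y.PosSemidef) : 0 ≤ trace (X * Y) := by
  obtain ⟨C, rfl⟩ := exists_eq_transpose_mul_self hX
  rw [Matrix.mul_assoc, trace_mul_comm]
  exact (posSemidef_conj hY C).trace_nonneg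

lemma exists_posSemidef_sub_smul_one [DecidableEq ι] {X : Matrix ι ι ℝ} (hX : X.PosDef) :
    ∃ c : ℝ, 0 < c ∧ (X - c • (1 : Matrix ι ι ℝ)).PosSemidef := by
  have hcont : Continuous fun y : EuclideanSpace ℝ ι => y.ofLp ⬝ᵥ (X *ᵥ y.ofLp) := by
    fun_prop
  have key : ∃ c : ℝ, 0 < c ∧ ∀ y : EuclideanSpace ℝ ι, ‖y‖ = 1 → c ≤ y.ofLp ⬝ᵥ (X *ᵥ y.ofLp) := by
    rcases (Metric.sphere (0 : EuclideanSpace ℝ ι) 1).eq_empty_or_nonempty with hs | hs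
    · refine ⟨1, one_pos, fun y hy => ?_⟩
      have : y ∈ Metric.sphere (0 : EuclideanSpace ℝ ι) 1 := by simpa using hy
      simp [hs] at this
    · obtain ⟨y, hy, hmin⟩ := (isCompact_sphere (0 : EuclideanSpace ℝ ι) 1).exists_isMinOn hs
        hcont.continuousOn
      refine ⟨_, ?_, fun z hz => hmin (by simpa using hz)⟩
      have hy0 : y.ofLp ≠ 0 := by
        intro h
        have : y = 0 := by ext i; simp [h]
        simp [this] at hy
      simpa using hX.dotProduct_mulVec_pos hy0
  obtain ⟨c, hc, h⟩ := key
  refine ⟨c, hc, posSemidef_of_quadratic_nonneg ?_ fun y => ?_⟩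
  · simp [transpose_eq_of_posSemidef hX.posSemidef]
  · rw [sub_mulVec, dotProduct_sub, smul_mulVec, one_mulVec, dotProduct_smul, smul_eq_mul,
      sub_nonneg]
    by_cases hy : y = 0
    · simp [hy]
    set z : EuclideanSpace ℝ ι := WithLp.toLp 2 y with hz
    have hz0 : 0 < ‖z‖ := norm_pos_iff.2 (by simpa [hz] using hy)
    have h1 := h (‖z‖⁻¹ • z) (by rw [norm_smul, norm_inv, norm_norm, inv_mul_cancel₀ hz0.ne'])
    have h2 : y ⬝ᵥ y = ‖z‖ ^ 2 := by
      rw [EuclideanSpace.real_norm_sq_eq]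
      simp [dotProduct, hz, sq]
    have h3 : (‖z‖⁻¹ • z).ofLp ⬝ᵥ (X *ᵥ (‖z‖⁻¹ • z).ofLp) = (‖z‖ ^ 2)⁻¹ * (y ⬝ᵥ (X *ᵥ y)) := by
      simp only [WithLp.ofLp_smul, mulVec_smul, dotProduct_smul, smul_dotProduct, smul_eq_mul, hz]
      ring
    rw [h3, ← div_eq_inv_mul, le_div_iff₀ (by positivity)] at h1
    rwa [h2]

lemma quadratic_of_posSemidef_sub [DecidableEq ι] {X : Matrix ι ι ℝ} {c : ℝ}
    (h : (X - c • (1 : Matrix ι ι ℝ)).PosSemidef) (y : ι → ℝ) : c * (y ⬝ᵥ y) ≤ y ⬝ᵥ (X *ᵥ y) := by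
  have := quadratic_nonneg h y
  rwa [sub_mulVec, dotProduct_sub, smul_mulVec, one_mulVec, dotProduct_smul, smul_eq_mul,
    sub_nonneg] at this

lemma smul_trace_le_trace_mul [DecidableEq ι] {X Y : Matrix ι ι ℝ} {c : ℝ}
    (h : (X - c • (1 : Matrix ι ι ℝ)).PosSemidef) (hY : Y.PosSemidef) :
    c * trace Y ≤ trace (X * Y) := by
  have := trace_mul_nonneg h hY
  rwa [sub_mul, trace_sub, smul_mul_assoc, one_mul, trace_smul, smul_eq_mul, sub_nonneg] at this

lemma quadratic_add_le {X : Matrix ι ι ℝ} (hX : X.PosSemidef) (y z : ι → ℝ) :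
    (y + z) ⬝ᵥ (X *ᵥ (y + z)) ≤ 2 * (y ⬝ᵥ (X *ᵥ y)) + 2 * (z ⬝ᵥ (X *ᵥ z)) := by
  have := quadratic_nonneg hX (y - z)
  simp only [mulVec_add, mulVec_sub, dotProduct_add, dotProduct_sub, add_dotProduct,
    sub_dotProduct] at this ⊢
  linarith

lemma quadratic_le_trace [DecidableEq ι] {X : Matrix ι ι ℝ} (hX : X.PosSemidef)
    (y : ι → ℝ) : y ⬝ᵥ (X *ᵥ y) ≤ trace X * (y ⬝ᵥ y) := by
  obtain ⟨C, rfl⟩ := exists_eq_transpose_mul_self hX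
  have h := dotProduct_conj_mulVec (1 : Matrix ι ι ℝ) C y
  rw [Matrix.mul_one, one_mulVec] at h
  rw [h, trace_mul_comm, trace, Finset.sum_mul]
  simp only [dotProduct, diag, mul_apply, transpose_apply, mulVec]
  refine Finset.sum_le_sum fun i _ => ?_
  have := Finset.sum_mul_sq_le_sq_mul_sq Finset.univ (C i) y
  simpa only [sq] using this

lemma conj_apply_self {ι κ : Type*} [Fintype ι] {Z : Matrix ι ι ℝ} (F : Matrix κ ι ℝ) (i : κ) :
    (F * Z * Fᵀ) i i = F i ⬝ᵥ (Z *ᵥ F i) := by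
  simp only [mul_apply, transpose_apply, dotProduct, mulVec, Finset.sum_mul, Finset.mul_sum]
  rw [Finset.sum_comm]
  exact Finset.sum_congr rfl fun _ _ => Finset.sum_congr rfl fun _ _ => by ring

end PosSemidef

/-! ### Stable closed loops in homogeneous coordinates -/

section Blocks

variable {n : ℕ}

/-- The matrix of the affine map `x ↦ F x + b` in homogeneous coordinates. -/
def affineMat (F : Matrix (Fin n) (Fin n) ℝ) (b : Fin n → ℝ) :
    Matrix (Fin n ⊕ Unit) (Fin n ⊕ Unit) ℝ :=
  fromBlocks F (replicateCol Unit b) 0 1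

variable {F : Matrix (Fin n) (Fin n) ℝ} (b : Fin n → ℝ)

lemma exists_fixedPoint (hF : Tendsto (fun k => F ^ k) atTop (𝓝 0)) : ∃ x, F *ᵥ x + b = x := by
  have hinj : Function.Injective (mulVecLin (1 - F)) := by
    rw [← LinearMap.ker_eq_bot, LinearMap.ker_eq_bot']
    intro v hv
    have h1 : F *ᵥ v = v := by
      rw [mulVecLin_apply, sub_mulVec, one_mulVec, sub_eq_zero] at hv
      exact hv.symm
    have h2 : ∀ k, F ^ k *ᵥ v = v := fun k => by
      induction k with
      | zero => simp
      | succ k ih => rw [pow_succ, ← mulVec_mulVec, h1, ih]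
    have hc : Continuous fun X : Matrix (Fin n) (Fin n) ℝ => X *ᵥ v := by fun_prop
    have h3 := (hc.tendsto 0).comp hF
    simp only [Function.comp_def, h2, zero_mulVec] at h3
    exact tendsto_nhds_unique tendsto_const_nhds h3
  obtain ⟨x, hx⟩ := LinearMap.surjective_of_injective hinj b
  refine ⟨x, ?_⟩
  rw [← hx, mulVecLin_apply, sub_mulVec, one_mulVec]
  abel

lemma fromBlocks_pow (k : ℕ) : ∃ c : Fin n → ℝ,
    affineMat F b ^ k = affineMat (F ^ k) c := by
  induction k with
  | zero => exact ⟨0, by simp [affineMat, fromBlocks_one]⟩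
  | succ k ih =>
    obtain ⟨c, hc⟩ := ih
    refine ⟨F *ᵥ c + b, ?_⟩
    rw [pow_succ', hc, affineMat, affineMat, affineMat, fromBlocks_multiply, pow_succ']
    simp [replicateCol_mulVec, replicateCol_add]

lemma fromBlocks_pow_of_fixedPoint {x : Fin n → ℝ} (hx : F *ᵥ x + b = x) (k : ℕ) :
    affineMat F b ^ k =
      affineMat (F ^ k) (x - F ^ k *ᵥ x) := by
  induction k with
  | zero => simp [affineMat, fromBlocks_one]
  | succ k ih =>
    rw [pow_succ', ih, affineMat, affineMat, affineMat, fromBlocks_multiply, pow_succ']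
    congr 1
    · simp
    · rw [Matrix.mul_one, ← replicateCol_mulVec, ← replicateCol_add, mulVec_sub, mulVec_mulVec]
      congr 1
      nth_rewrite 3 [← hx]
      abel
    · simp
    · simp

/-- A stable affine closed loop settles in homogeneous coordinates. -/
lemma settles_fromBlocks (hF : Tendsto (fun k => F ^ k) atTop (𝓝 0)) :
    Settles (affineMat F b) (Sum.inr ()) where
  row := by
    ext (j | j)
    · simp [affineMat]
    · simp [affineMat]
  tendsto X hX := by
    obtain ⟨x, hx⟩ := exists_fixedPoint b hF
    have hc : Continuous fun G : Matrix (Fin n) (Fin n) ℝ =>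
        affineMat G (x - G *ᵥ x) :=
      continuous_id.matrix_fromBlocks (by fun_prop) continuous_const continuous_const
    have hc' : Continuous fun G : Matrix (Fin n) (Fin n) ℝ =>
        affineMat G (x - G *ᵥ x) * X *
          (affineMat G (x - G *ᵥ x))ᵀ :=
      (hc.mul continuous_const).mul hc.matrix_transpose
    have h := (hc'.tendsto 0).comp hF
    simp only [Function.comp_def, ← fromBlocks_pow_of_fixedPoint b hx] at h
    convert h using 2
    symm
    ext (i | i) (j | j) <;> simp [affineMat, Matrix.mul_apply, hX]

end Blocks

/-! ### The stationary second moments and the average cost -/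

section StationaryMoment

lemma posSemidef_of_tendsto {ι : Type*} [Fintype ι] {Z : ℕ → Matrix ι ι ℝ} {L : Matrix ι ι ℝ}
    (hZ : ∀ k, (Z k).PosSemidef) (h : Tendsto Z atTop (𝓝 L)) : L.PosSemidef := by
  refine posSemidef_of_quadratic_nonneg ?_ fun y => ?_
  · have h1 : Tendsto (fun k => (Z k)ᵀ) atTop (𝓝 Lᵀ) :=
      (continuous_id.matrix_transpose.tendsto L).comp h
    simp only [transpose_eq_of_posSemidef (hZ _)] at h1
    exact tendsto_nhds_unique h1 h
  · have hc : Continuous fun X : Matrix ι ι ℝ => y ⬝ᵥ (X *ᵥ y) := by fun_prop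
    exact ge_of_tendsto' ((hc.tendsto L).comp h) fun k => quadratic_nonneg (hZ k) y

lemma Settles.posSemidef_stationary {ι : Type*} [Fintype ι] [DecidableEq ι] {Φ V : Matrix ι ι ℝ}
    {e : ι} (h : Settles Φ e) (hV : V.PosSemidef) (hVe : V e e = 0) :
    (stationary Φ e V).PosSemidef := by
  let Z : ℕ → Matrix ι ι ℝ := fun k => Nat.rec (single e e 1) (fun _ X => Φ * X * Φᵀ + V) k
  refine posSemidef_of_tendsto (Z := Z) (fun k => ?_)
    (h.tendsto_stationary hVe (by simp [Z]) fun k => rfl)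
  induction k with
  | zero =>
    have := posSemidef_vecMulVec_self_star (Pi.single e (1 : ℝ))
    rwa [star_trivial, ← single_eq_single_vecMulVec_single] at this
  | succ k ih => exact (posSemidef_conj ih Φ).add hV

variable {n m : ℕ} {A : Matrix (Fin n) (Fin n) ℝ} {B : Matrix (Fin n) (Fin m) ℝ}
  {W Q : Matrix (Fin n) (Fin n) ℝ} {R : Matrix (Fin m) (Fin m) ℝ} {δ : Fin n → ℝ}
  {θ : Policy n m}

/-- The policies that stabilize `(A, B)`. -/
def stabilizing (A : Matrix (Fin n) (Fin n) ℝ) (B : Matrix (Fin n) (Fin m) ℝ) :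
    Set (Policy n m) :=
  {θ | Tendsto (fun k => (A + B * θ.K) ^ k) atTop (𝓝 0)}

/-- The stationary second moments of the closed loop in homogeneous coordinates. -/
def statMoment (A : Matrix (Fin n) (Fin n) ℝ) (B : Matrix (Fin n) (Fin m) ℝ)
    (W : Matrix (Fin n) (Fin n) ℝ) (θ : Policy n m) :
    Matrix (Fin n ⊕ Unit) (Fin n ⊕ Unit) ℝ :=
  stationary (closedLoop A B θ) (Sum.inr ()) (noiseCov W)

lemma closedLoop_eq_affineMat (A : Matrix (Fin n) (Fin n) ℝ) (B : Matrix (Fin n) (Fin m) ℝ)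
    (θ : Policy n m) : closedLoop A B θ = affineMat (A + B * θ.K) (B *ᵥ θ.l) :=
  closedLoop_eq_fromBlocks A B θ

lemma settles_closedLoop (h : θ ∈ stabilizing A B) : Settles (closedLoop A B θ) (Sum.inr ()) := by
  rw [closedLoop_eq_affineMat]
  exact settles_fromBlocks _ h

lemma quadratic_noiseCov (W : Matrix (Fin n) (Fin n) ℝ) (y : Fin n ⊕ Unit → ℝ) :
    y ⬝ᵥ (noiseCov W *ᵥ y) = (y ∘ Sum.inl) ⬝ᵥ (W *ᵥ (y ∘ Sum.inl)) := by
  simp [noiseCov, fromBlocks_mulVec, dotProduct]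

lemma posSemidef_noiseCov (hW : W.PosSemidef) : (noiseCov W).PosSemidef := by
  refine posSemidef_of_quadratic_nonneg ?_ fun y => ?_
  · simp [noiseCov, fromBlocks_transpose, transpose_eq_of_posSemidef hW]
  · rw [quadratic_noiseCov]
    exact quadratic_nonneg hW _

lemma noiseCov_inr (W : Matrix (Fin n) (Fin n) ℝ) : noiseCov W (Sum.inr ()) (Sum.inr ()) = 0 := rfl

lemma posSemidef_statMoment (hW : W.PosSemidef) (h : θ ∈ stabilizing A B) :
    (statMoment A B W θ).PosSemidef :=
  (settles_closedLoop h).posSemidef_stationary (posSemidef_noiseCov hW) (noiseCov_inr W)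

lemma statMoment_inr (h : θ ∈ stabilizing A B) :
    statMoment A B W θ (Sum.inr ()) (Sum.inr ()) = 1 :=
  (settles_closedLoop h).stationary_apply_self (noiseCov_inr W)

lemma statMoment_eq (h : θ ∈ stabilizing A B) :
    statMoment A B W θ =
      closedLoop A B θ * statMoment A B W θ * (closedLoop A B θ)ᵀ + noiseCov W :=
  (settles_closedLoop h).stationary_eq (noiseCov_inr W)

lemma quadratic_noise_le_statMoment (hW : W.PosSemidef) (h : θ ∈ stabilizing A B)
    (y : Fin n ⊕ Unit → ℝ) :
    (y ∘ Sum.inl) ⬝ᵥ (W *ᵥ (y ∘ Sum.inl)) ≤ y ⬝ᵥ (statMoment A B W θ *ᵥ y) := by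
  rw [statMoment_eq h, add_mulVec, dotProduct_add, quadratic_noiseCov]
  exact le_add_of_nonneg_left (quadratic_nonneg (posSemidef_conj (posSemidef_statMoment hW h) _) y)

lemma conj_noiseCov (W : Matrix (Fin n) (Fin n) ℝ) (θ : Policy n m) (k : ℕ) :
    closedLoop A B θ ^ k * noiseCov W * (closedLoop A B θ ^ k)ᵀ =
      noiseCov ((A + B * θ.K) ^ k * W * ((A + B * θ.K) ^ k)ᵀ) := by
  obtain ⟨c, hc⟩ := fromBlocks_pow (F := A + B * θ.K) (B *ᵥ θ.l) k
  rw [closedLoop_eq_affineMat, hc, affineMat, noiseCov, fromBlocks_transpose, fromBlocks_multiply,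
    fromBlocks_multiply, noiseCov]
  simp

lemma trace_noiseCov (W : Matrix (Fin n) (Fin n) ℝ) : trace (noiseCov W) = trace W := by
  simp [noiseCov, trace]

/-- The trace of the state covariance after `k` steps. -/
def traceCov (A : Matrix (Fin n) (Fin n) ℝ) (B : Matrix (Fin n) (Fin m) ℝ)
    (W : Matrix (Fin n) (Fin n) ℝ) (θ : Policy n m) (k : ℕ) : ℝ :=
  ∑ i ∈ Finset.range k, trace ((A + B * θ.K) ^ i * W * ((A + B * θ.K) ^ i)ᵀ)

lemma traceCov_mono (hW : W.PosSemidef) : Monotone (traceCov A B W θ) :=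
  monotone_nat_of_le_succ fun k => by
    rw [traceCov, traceCov, Finset.sum_range_succ]
    exact le_add_of_nonneg_right (posSemidef_conj hW _).trace_nonneg

lemma traceCov_le_trace_statMoment (hW : W.PosSemidef) (h : θ ∈ stabilizing A B) (k : ℕ) :
    traceCov A B W θ k ≤ trace (statMoment A B W θ) := by
  have h1 := congrArg trace (eq_conj_pow_add_sum (statMoment_eq (W := W) h) k)
  rw [trace_add, trace_sum] at h1
  simp only [conj_noiseCov, trace_noiseCov] at h1
  rw [h1, traceCov]
  exact le_add_of_nonneg_left (posSemidef_conj (posSemidef_statMoment hW h) _).trace_nonneg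

/-- A bound on the state covariance forces stability. -/
lemma mem_stabilizing_of_traceCov_le (hW : W.PosDef) {c : ℝ} (h : ∀ k, traceCov A B W θ k ≤ c) :
    θ ∈ stabilizing A B := by
  obtain ⟨ω, hω, hWω⟩ := exists_posSemidef_sub_smul_one hW
  have h1 : Tendsto (fun i => trace ((A + B * θ.K) ^ i * W * ((A + B * θ.K) ^ i)ᵀ)) atTop (𝓝 0) :=
    (summable_of_sum_range_le (fun i => (posSemidef_conj hW.posSemidef _).trace_nonneg)
      h).tendsto_atTop_zero
  have h2 : ∀ (G : Matrix (Fin n) (Fin n) ℝ) a b, ω * (G a b) ^ 2 ≤ trace (G * W * Gᵀ) := by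
    intro G a b
    have e1 : trace (G * W * Gᵀ) = ∑ a, G a ⬝ᵥ (W *ᵥ G a) :=
      Finset.sum_congr rfl fun a _ => conj_apply_self G a
    rw [e1]
    refine le_trans ?_ (Finset.single_le_sum (fun a _ => quadratic_nonneg hW.posSemidef (G a))
      (Finset.mem_univ a))
    refine le_trans ?_ (quadratic_of_posSemidef_sub hWω (G a))
    refine mul_le_mul_of_nonneg_left ?_ hω.le
    rw [dotProduct, sq]
    exact Finset.single_le_sum (f := fun b => G a b * G a b) (fun _ _ => mul_self_nonneg _)
      (Finset.mem_univ b)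
  refine tendsto_pi_nhds.2 fun a => tendsto_pi_nhds.2 fun b => ?_
  have h3 : Tendsto (fun i => (((A + B * θ.K) ^ i : Matrix (Fin n) (Fin n) ℝ) a b) ^ 2) atTop (𝓝 0) := by
    have h4 := h1.const_mul ω⁻¹
    rw [mul_zero] at h4
    refine squeeze_zero (fun _ => sq_nonneg _) (fun i => ?_) h4
    rw [← div_eq_inv_mul, le_div_iff₀ hω, mul_comm]
    exact h2 _ a b
  have h5 := (Real.continuous_sqrt.tendsto 0).comp h3
  simp only [Function.comp_def, Real.sqrt_sq_eq_abs, Real.sqrt_zero] at h5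
  exact (tendsto_zero_iff_abs_tendsto_zero _).2 h5

lemma posSemidef_stageWeight (hQ : Q.PosSemidef) (hR : R.PosSemidef) :
    (stageWeight Q R δ θ).PosSemidef :=
  (posSemidef_conj' hQ _).add (posSemidef_conj' hR _)

/-- The average cost of a stabilizing policy. -/
def statCost (A : Matrix (Fin n) (Fin n) ℝ) (B : Matrix (Fin n) (Fin m) ℝ)
    (W Q : Matrix (Fin n) (Fin n) ℝ) (R : Matrix (Fin m) (Fin m) ℝ) (δ : Fin n → ℝ)
    (θ : Policy n m) : ℝ :=
  trace (stageWeight Q R δ θ * statMoment A B W θ)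

lemma statCost_nonneg (hQ : Q.PosSemidef) (hR : R.PosSemidef) (hW : W.PosSemidef)
    (h : θ ∈ stabilizing A B) : 0 ≤ statCost A B W Q R δ θ :=
  trace_mul_nonneg (posSemidef_stageWeight hQ hR) (posSemidef_statMoment hW h)

section Average

variable {Ω : Type*} [MeasurableSpace Ω] {P : Measure Ω} [IsProbabilityMeasure P]
  {w : ℕ → Ω → EuclideanSpace ℝ (Fin n)} (x₀ : Fin n → ℝ)

lemma averageCost_eq_statCost (hQ : Q.PosSemidef) (hR : R.PosSemidef) (hW : W.PosSemidef)
    (hw : ∀ t, ProbabilityTheory.HasLaw (w t) (ProbabilityTheory.multivariateGaussian 0 W) P)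
    (hi : ProbabilityTheory.iIndepFun w P) (h : θ ∈ stabilizing A B) :
    averageCost A B Q R δ x₀ P w θ = ENNReal.ofReal (statCost A B W Q R δ θ) := by
  have h1 : Tendsto (stateMoment A B x₀ θ P w) atTop (𝓝 (statMoment A B W θ)) :=
    (settles_closedLoop h).tendsto_stationary (noiseCov_inr W)
      (by simp [stateMoment_zero, vecMulVec_apply, hom])
      fun k => stateMoment_succ A B x₀ θ hW hw hi k
  have hc : Continuous fun Z => trace (stageWeight Q R δ θ * Z) := by fun_prop
  have h2 := ((hc.tendsto _).comp h1).cesaro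
  rw [averageCost_eq_limsup A B x₀ θ hQ hR δ hw]
  refine Tendsto.limsup_eq ?_
  refine ((ENNReal.continuous_ofReal.tendsto _).comp h2).congr' ?_
  filter_upwards [eventually_gt_atTop 0] with N hN
  have hN' : (0 : ℝ) < N := by exact_mod_cast hN
  simp only [Function.comp_apply]
  rw [← div_eq_inv_mul, ENNReal.ofReal_div_of_pos hN', ENNReal.ofReal_natCast]

lemma eq_conj_pow_add_sum_of_recursion {ι : Type*} [Fintype ι] [DecidableEq ι]
    {Φ V : Matrix ι ι ℝ} {Z : ℕ → Matrix ι ι ℝ} (hZ : ∀ k, Z (k + 1) = Φ * Z k * Φᵀ + V) (k : ℕ) :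
    Z k = Φ ^ k * Z 0 * (Φ ^ k)ᵀ + ∑ i ∈ Finset.range k, Φ ^ i * V * (Φ ^ i)ᵀ := by
  induction k with
  | zero => simp
  | succ k ih =>
    rw [hZ, ih, Finset.sum_range_succ', mul_add, add_mul, ← conj_pow_succ, Finset.mul_sum,
      Finset.sum_mul]
    simp only [← conj_pow_succ]
    simp [add_assoc]

lemma errorMat_mul_noiseCov (δ : Fin n → ℝ) (W : Matrix (Fin n) (Fin n) ℝ) :
    errorMat δ * noiseCov W * (errorMat δ)ᵀ = W := by
  rw [errorMat, noiseCov, transpose_fromCols, fromCols_mul_fromBlocks, fromCols_mul_fromRows]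
  simp

lemma trace_stageWeight_mul (Q : Matrix (Fin n) (Fin n) ℝ) (R : Matrix (Fin m) (Fin m) ℝ)
    (δ : Fin n → ℝ) (θ : Policy n m) (Z : Matrix (Fin n ⊕ Unit) (Fin n ⊕ Unit) ℝ) :
    trace (stageWeight Q R δ θ * Z) = trace (Q * (errorMat δ * Z * (errorMat δ)ᵀ)) +
      trace (R * (θ.toMatrix * Z * θ.toMatrixᵀ)) := by
  have h : ∀ {k : ℕ} (S : Matrix (Fin k) (Fin k) ℝ) (L : Matrix (Fin k) (Fin n ⊕ Unit) ℝ),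
      trace (Lᵀ * S * L * Z) = trace (S * (L * Z * Lᵀ)) := fun S L => by
    rw [Matrix.mul_assoc, Matrix.mul_assoc, trace_mul_comm]
    simp only [Matrix.mul_assoc]
  rw [stageWeight, add_mul, trace_add, h, h]

lemma traceCov_le_trace_mul (hQ : Q.PosSemidef) (hR : R.PosSemidef) (hW : W.PosSemidef) {q : ℝ}
    (hq : (Q - q • (1 : Matrix (Fin n) (Fin n) ℝ)).PosSemidef)
    (hw : ∀ t, ProbabilityTheory.HasLaw (w t) (ProbabilityTheory.multivariateGaussian 0 W) P)
    (hi : ProbabilityTheory.iIndepFun w P) (t : ℕ) :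
    q * traceCov A B W θ t ≤ trace (stageWeight Q R δ θ * stateMoment A B x₀ θ P w t) := by
  rw [eq_conj_pow_add_sum_of_recursion (fun k => stateMoment_succ A B x₀ θ hW hw hi k) t, mul_add,
    trace_add, Finset.mul_sum, trace_sum]
  have h0 : (stateMoment A B x₀ θ P w 0).PosSemidef := by
    have := posSemidef_vecMulVec_self_star (hom x₀)
    rwa [star_trivial, ← stateMoment_zero A B x₀ θ (P := P) (w := w)] at this
  refine le_add_of_nonneg_of_le
    (trace_mul_nonneg (posSemidef_stageWeight hQ hR) (posSemidef_conj h0 _)) ?_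
  rw [traceCov, Finset.mul_sum]
  refine Finset.sum_le_sum fun i _ => ?_
  have hp := posSemidef_conj hW ((A + B * θ.K) ^ i)
  rw [conj_noiseCov, trace_stageWeight_mul, errorMat_mul_noiseCov]
  exact le_add_of_le_of_nonneg (smul_trace_le_trace_mul hq hp)
    (trace_mul_nonneg hR (posSemidef_conj (posSemidef_noiseCov hp) _))

lemma mem_stabilizing_of_averageCost_ne_top (hQ : Q.PosDef) (hR : R.PosSemidef) (hW : W.PosDef)
    (hw : ∀ t, ProbabilityTheory.HasLaw (w t) (ProbabilityTheory.multivariateGaussian 0 W) P)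
    (hi : ProbabilityTheory.iIndepFun w P) (h : averageCost A B Q R δ x₀ P w θ ≠ ⊤) :
    θ ∈ stabilizing A B := by
  obtain ⟨q, hq, hQq⟩ := exists_posSemidef_sub_smul_one hQ
  rw [averageCost_eq_limsup A B x₀ θ hQ.posSemidef hR δ hw] at h
  obtain ⟨c, hc⟩ := ENNReal.lt_iff_exists_nnreal_btwn.1 (lt_top_iff_ne_top.2 h)
  obtain ⟨N₀, hN₀⟩ := eventually_atTop.1 (eventually_lt_of_limsup_lt hc.1)
  refine mem_stabilizing_of_traceCov_le hW (c := 2 * c / q) fun k => ?_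
  set N := k + N₀ + 1 with hN
  have hNpos : (0 : ℝ) < N := by rw [hN]; positivity
  have h1 := hN₀ (N + N) (by omega)
  have h2 : (0 : ℝ) < ((N + N : ℕ) : ℝ) := by push_cast; linarith
  rw [← ENNReal.ofReal_natCast, ← ENNReal.ofReal_div_of_pos h2, ← ENNReal.ofReal_coe_nnreal,
    ENNReal.ofReal_lt_ofReal_iff_of_nonneg, div_lt_iff₀ h2] at h1
  · have h3 : ∀ t, q * traceCov A B W θ t ≤
        trace (stageWeight Q R δ θ * stateMoment A B x₀ θ P w t) := fun t =>
      traceCov_le_trace_mul x₀ hQ.posSemidef hR hW.posSemidef hQq hw hi t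
    have h4 : (N : ℝ) * (q * traceCov A B W θ N) ≤ ∑ t ∈ Finset.range (N + N),
        trace (stageWeight Q R δ θ * stateMoment A B x₀ θ P w t) := by
      have h5 : ∀ t, 0 ≤ traceCov A B W θ t := fun t => by
        have := traceCov_mono (A := A) (B := B) (θ := θ) hW.posSemidef (Nat.zero_le t)
        simpa [traceCov] using this
      rw [Finset.sum_range_add]
      refine le_add_of_nonneg_of_le
        (Finset.sum_nonneg fun t _ => (mul_nonneg hq.le (h5 t)).trans (h3 t)) ?_
      have h6 := Finset.card_nsmul_le_sum (Finset.range N) (fun t =>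
        trace (stageWeight Q R δ θ * stateMoment A B x₀ θ P w (N + t))) (q * traceCov A B W θ N)
        fun t _ => (mul_le_mul_of_nonneg_left (traceCov_mono hW.posSemidef (by omega)) hq.le).trans
          (h3 _)
      simpa using h6
    have h7 : traceCov A B W θ k ≤ traceCov A B W θ N :=
      traceCov_mono hW.posSemidef (by omega)
    rw [le_div_iff₀ hq]
    push_cast at h1
    have h8 : (N : ℝ) * (q * traceCov A B W θ N) ≤ N * (2 * c) := by linarith
    have h9 := le_of_mul_le_mul_left h8 hNpos
    nlinarith
  · have h0 : ∀ t, (stateMoment A B x₀ θ P w t).PosSemidef := fun t => by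
      induction t with
      | zero =>
        have := posSemidef_vecMulVec_self_star (hom x₀)
        rwa [star_trivial, ← stateMoment_zero A B x₀ θ (P := P) (w := w)] at this
      | succ t ih =>
        rw [stateMoment_succ A B x₀ θ hW.posSemidef hw hi]
        exact (posSemidef_conj ih _).add (posSemidef_noiseCov hW.posSemidef)
    exact div_nonneg (Finset.sum_nonneg fun t _ =>
      trace_mul_nonneg (posSemidef_stageWeight hQ.posSemidef hR) (h0 t)) h2.le

end Average

end StationaryMoment

/-! ### The performance difference formula -/

section PerformanceDifference

lemma trace_mul_vecMulVec {ι : Type*} [Fintype ι] (S : Matrix ι ι ℝ) (y : ι → ℝ) :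
    trace (S * vecMulVec y y) = y ⬝ᵥ (S *ᵥ y) := by
  rw [mul_vecMulVec, trace_vecMulVec, dotProduct_comm]

/-- Solutions of the Bellman equation are nonnegative on the invariant hyperplane. -/
lemma Settles.bellman_nonneg {ι : Type*} [Fintype ι] [DecidableEq ι] {Φ C S : Matrix ι ι ℝ} {e : ι}
    {κ : ℝ} (h : Settles Φ e) (hC : C.PosSemidef) (hS : S + single e e κ = C + Φᵀ * S * Φ)
    {y : ι → ℝ} (hy : y e = 0) : 0 ≤ y ⬝ᵥ (S *ᵥ y) := by
  have hstep : ∀ z : ι → ℝ, z e = 0 →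
      (Φ *ᵥ z) e = 0 ∧ (Φ *ᵥ z) ⬝ᵥ (S *ᵥ (Φ *ᵥ z)) ≤ z ⬝ᵥ (S *ᵥ z) := by
    intro z hz
    refine ⟨by simp [mulVec, h.row, hz], ?_⟩
    have h1 := congrArg (fun X : Matrix ι ι ℝ => z ⬝ᵥ (X *ᵥ z)) hS
    simp only [add_mulVec, dotProduct_add, dotProduct_conj_mulVec] at h1
    have h2 : z ⬝ᵥ (single e e κ *ᵥ z) = 0 := by
      rw [single_mulVec]
      simp [hz]
    have h3 := quadratic_nonneg hC z
    linarith
  have hiter : ∀ k, (Φ ^ k *ᵥ y) e = 0 ∧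
      (Φ ^ k *ᵥ y) ⬝ᵥ (S *ᵥ (Φ ^ k *ᵥ y)) ≤ y ⬝ᵥ (S *ᵥ y) := fun k => by
    induction k with
    | zero => simp [hy]
    | succ k ih =>
      have := hstep _ ih.1
      rw [pow_succ', ← mulVec_mulVec]
      exact ⟨this.1, this.2.trans ih.2⟩
  have hlim := h.tendsto (vecMulVec y y) (by simp [vecMulVec_apply, hy])
  have hc : Continuous fun X : Matrix ι ι ℝ => trace (S * X) := by fun_prop
  have hlim' := (hc.tendsto 0).comp hlim
  simp only [Function.comp_def, mul_zero, trace_zero] at hlim'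
  refine le_of_tendsto' hlim' fun k => ?_
  rw [mul_vecMulVec, vecMulVec_mul, vecMul_transpose, trace_mul_vecMulVec]
  exact (hiter k).2

variable {n m : ℕ} {A : Matrix (Fin n) (Fin n) ℝ} {B : Matrix (Fin n) (Fin m) ℝ}
  {W Q : Matrix (Fin n) (Fin n) ℝ} {R : Matrix (Fin m) (Fin m) ℝ} {δ : Fin n → ℝ}
  {θ : Policy n m}

lemma toMatrix_sub (θ θ' : Policy n m) : (θ - θ').toMatrix = θ.toMatrix - θ'.toMatrix := rfl

lemma toMatrix_smul (c : ℝ) (θ : Policy n m) : (c • θ).toMatrix = c • θ.toMatrix := rfl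

lemma trace_conj_mul {ι : Type*} [Fintype ι] (Φ S Z : Matrix ι ι ℝ) :
    trace (Φᵀ * S * Φ * Z) = trace (S * (Φ * Z * Φᵀ)) := by
  rw [Matrix.mul_assoc, Matrix.mul_assoc, trace_mul_comm]
  simp only [Matrix.mul_assoc]

/-- The cost difference to any other stabilizing policy is an explicit quadratic expression in the
difference of the policies, weighted by the stationary moments of the other policy. -/
lemma exists_performance_difference (hQ : Q.PosSemidef) (hR : R.PosSemidef)
    (h : θ ∈ stabilizing A B) :
    ∃ (G : Matrix (Fin m) (Fin m) ℝ) (E : Matrix (Fin m) (Fin n ⊕ Unit) ℝ), (G - R).PosSemidef ∧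
      ∀ θ' ∈ stabilizing A B, statCost A B W Q R δ θ' - statCost A B W Q R δ θ =
        trace (((θ' - θ).toMatrixᵀ * G * (θ' - θ).toMatrix + (θ' - θ).toMatrixᵀ * E +
          Eᵀ * (θ' - θ).toMatrix) * statMoment A B W θ') := by
  have hC : (stageWeight Q R δ θ).PosSemidef := posSemidef_stageWeight hQ hR
  obtain ⟨S, κ, hS, hSκ⟩ := (settles_closedLoop h).exists_bellman (transpose_eq_of_posSemidef hC)
  set H : Matrix (Fin n ⊕ Unit) (Fin m) ℝ := fromRows B 0 with hH
  refine ⟨R + Hᵀ * S * H, R * θ.toMatrix + Hᵀ * S * closedLoop A B θ, ?_, fun θ' h' => ?_⟩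
  · rw [add_sub_cancel_left]
    refine posSemidef_of_quadratic_nonneg (by simp [hS, Matrix.mul_assoc]) fun u => ?_
    rw [dotProduct_conj_mulVec]
    exact (settles_closedLoop h).bellman_nonneg hC hSκ (by simp [hH, fromRows_mulVec])
  · have key : ∀ {ϑ : Policy n m}, ϑ ∈ stabilizing A B →
        trace (S * statMoment A B W ϑ) + κ = trace (stageWeight Q R δ θ * statMoment A B W ϑ) +
          trace ((closedLoop A B θ)ᵀ * S * closedLoop A B θ * statMoment A B W ϑ) ∧
        trace (S * statMoment A B W ϑ) =
          trace ((closedLoop A B ϑ)ᵀ * S * closedLoop A B ϑ * statMoment A B W ϑ) +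
            trace (S * noiseCov W) := fun {ϑ} hϑ => by
      constructor
      · rw [← trace_add, ← add_mul, ← hSκ, add_mul, trace_add, trace_mul_comm (single _ _ κ),
          Settles.trace_mul_single, statMoment_inr hϑ, one_mul]
      · rw [trace_conj_mul, ← trace_add, ← mul_add, ← statMoment_eq hϑ]
    obtain ⟨k1, k2⟩ := key h
    obtain ⟨k3, k4⟩ := key h'
    set Δ := (θ' - θ).toMatrix with hΔ
    have hθ' : θ'.toMatrix = θ.toMatrix + Δ := by rw [hΔ, toMatrix_sub]; abel
    have hcl : closedLoop A B θ' = closedLoop A B θ + H * Δ := by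
      rw [closedLoop, closedLoop, hθ', Matrix.mul_add, add_assoc]
    have hid : stageWeight Q R δ θ' - stageWeight Q R δ θ +
        ((closedLoop A B θ')ᵀ * S * closedLoop A B θ' -
          (closedLoop A B θ)ᵀ * S * closedLoop A B θ) =
        Δᵀ * (R + Hᵀ * S * H) * Δ + Δᵀ * (R * θ.toMatrix + Hᵀ * S * closedLoop A B θ) +
          (R * θ.toMatrix + Hᵀ * S * closedLoop A B θ)ᵀ * Δ := by
      rw [stageWeight, stageWeight, hcl, hθ']
      simp only [transpose_add, transpose_mul, Matrix.mul_add, Matrix.add_mul, Matrix.mul_assoc, hS,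
        transpose_transpose, transpose_eq_of_posSemidef hR]
      abel
    rw [← hid, add_mul, sub_mul, sub_mul, trace_add, trace_sub, trace_sub, statCost, statCost]
    linarith

end PerformanceDifference

/-! ### Smoothness of the cost -/

section Smooth

variable {n m : ℕ} {A : Matrix (Fin n) (Fin n) ℝ} {B : Matrix (Fin n) (Fin m) ℝ}
  {W Q : Matrix (Fin n) (Fin n) ℝ} {R : Matrix (Fin m) (Fin m) ℝ} {δ : Fin n → ℝ}
  {θ : Policy n m}

lemma contDiff_toMatrix_apply {k : WithTop ℕ∞} (i : Fin m) (a : Fin n ⊕ Unit) :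
    ContDiff ℝ k fun θ : Policy n m => θ.toMatrix i a :=
  (EuclideanSpace.proj (𝕜 := ℝ) (i, a)).contDiff

lemma contDiff_closedLoop_apply {k : WithTop ℕ∞} (a b : Fin n ⊕ Unit) :
    ContDiff ℝ k fun θ : Policy n m => closedLoop A B θ a b := by
  simp only [closedLoop, Matrix.add_apply, Matrix.mul_apply]
  exact contDiff_const.add (ContDiff.sum fun i _ =>
    contDiff_const.mul (contDiff_toMatrix_apply i b))

lemma contDiff_stageWeight_apply {k : WithTop ℕ∞} (a b : Fin n ⊕ Unit) :
    ContDiff ℝ k fun θ : Policy n m => stageWeight Q R δ θ a b := by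
  simp only [stageWeight, Matrix.add_apply, Matrix.mul_apply, transpose_apply]
  refine contDiff_const.add (ContDiff.sum fun i _ => ContDiff.mul (ContDiff.sum fun j _ => ?_)
    (contDiff_toMatrix_apply i b))
  exact (contDiff_toMatrix_apply j a).mul contDiff_const

lemma contDiffAt_statMoment_apply {k : WithTop ℕ∞} (h : θ ∈ stabilizing A B)
    (a b : Fin n ⊕ Unit) : ContDiffAt ℝ k (fun ϑ => statMoment A B W ϑ a b) θ :=
  contDiffAt_stationary (fun _ _ => contDiff_closedLoop_apply _ _) (settles_closedLoop h) _ a b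

lemma continuousAt_statMoment (h : θ ∈ stabilizing A B) :
    ContinuousAt (statMoment A B W : Policy n m → _) θ :=
  continuousAt_pi.2 fun a => continuousAt_pi.2 fun b =>
    (contDiffAt_statMoment_apply (k := 1) h a b).continuousAt

lemma contDiffAt_statCost {k : WithTop ℕ∞} (h : θ ∈ stabilizing A B) :
    ContDiffAt ℝ k (statCost A B W Q R δ) θ := by
  unfold statCost
  simp only [trace, diag, Matrix.mul_apply]
  exact ContDiffAt.sum fun a _ => ContDiffAt.sum fun b _ =>
    (contDiff_stageWeight_apply a b).contDiffAt.mul (contDiffAt_statMoment_apply h b a)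

lemma continuous_K : Continuous (Policy.K : Policy n m → _) :=
  continuous_matrix fun i j => (EuclideanSpace.proj (𝕜 := ℝ) (i, Sum.inl j)).continuous

lemma isOpen_stabilizing : IsOpen (stabilizing A B : Set (Policy n m)) :=
  isOpen_setOf_schur.preimage (continuous_const.add (continuous_const.matrix_mul continuous_K))

lemma contDiffAt_of_eq_statCost {J : Policy n m → ℝ}
    (hJ : ∀ ϑ ∈ stabilizing A B, J ϑ = statCost A B W Q R δ ϑ) {k : WithTop ℕ∞}
    (h : θ ∈ stabilizing A B) : ContDiffAt ℝ k J θ :=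
  (contDiffAt_statCost h).congr_of_eventuallyEq
    (eventually_of_mem (isOpen_stabilizing.mem_nhds h) hJ)

/-- The derivative of the cost, read off from the performance difference formula. -/
lemma inner_gradient_eq_trace {J : Policy n m → ℝ}
    (hJ : ∀ ϑ ∈ stabilizing A B, J ϑ = statCost A B W Q R δ ϑ)
    (h : θ ∈ stabilizing A B) {G : Matrix (Fin m) (Fin m) ℝ}
    {E : Matrix (Fin m) (Fin n ⊕ Unit) ℝ}
    (hd : ∀ θ' ∈ stabilizing A B, statCost A B W Q R δ θ' - statCost A B W Q R δ θ =
        trace (((θ' - θ).toMatrixᵀ * G * (θ' - θ).toMatrix + (θ' - θ).toMatrixᵀ * E +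
          Eᵀ * (θ' - θ).toMatrix) * statMoment A B W θ')) (D : Policy n m) :
    inner ℝ (gradient J θ) D =
      trace ((D.toMatrixᵀ * E + Eᵀ * D.toMatrix) * statMoment A B W θ) := by
  have hdiff : DifferentiableAt ℝ J θ :=
    (contDiffAt_of_eq_statCost hJ h (k := 1)).differentiableAt one_ne_zero
  have h1 : HasDerivAt (fun s : ℝ => J (θ + s • D)) (inner ℝ (gradient J θ) D) 0 := by
    have hl : HasDerivAt (fun s : ℝ => θ + s • D) D 0 := by
      simpa using ((hasDerivAt_id (0 : ℝ)).smul_const D).const_add θ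
    have hg : HasFDerivAt J (InnerProductSpace.toDual ℝ _ (gradient J θ)) (θ + (0 : ℝ) • D) := by
      simpa using hdiff.hasGradientAt.hasFDerivAt
    exact hg.comp_hasDerivAt 0 hl
  rw [hasDerivAt_iff_tendsto_slope_zero] at h1
  have hcont : Continuous fun s : ℝ => θ + s • D := by fun_prop
  have hmem : ∀ᶠ s : ℝ in 𝓝 0, θ + s • D ∈ stabilizing A B :=
    hcont.continuousAt.eventually (by simpa using isOpen_stabilizing.mem_nhds h)
  have hZ : Tendsto (fun s : ℝ => statMoment A B W (θ + s • D)) (𝓝 0)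
      (𝓝 (statMoment A B W θ)) := by
    have := ContinuousAt.comp (f := fun s : ℝ => θ + s • D) (x := 0)
      (g := (statMoment A B W : Policy n m → _))
      (by simpa using continuousAt_statMoment h) hcont.continuousAt
    simpa [ContinuousAt, Function.comp_def] using this
  have hφ : Tendsto (fun s : ℝ => s * trace (D.toMatrixᵀ * G * D.toMatrix *
      statMoment A B W (θ + s • D)) +
        trace ((D.toMatrixᵀ * E + Eᵀ * D.toMatrix) * statMoment A B W (θ + s • D))) (𝓝 0)
      (𝓝 (0 * trace (D.toMatrixᵀ * G * D.toMatrix * statMoment A B W θ) +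
        trace ((D.toMatrixᵀ * E + Eᵀ * D.toMatrix) * statMoment A B W θ))) := by
    have hc : ∀ X : Matrix (Fin n ⊕ Unit) (Fin n ⊕ Unit) ℝ,
        Continuous fun Z => trace (X * Z) := fun X => by fun_prop
    exact (tendsto_id.mul (((hc _).tendsto _).comp hZ)).add (((hc _).tendsto _).comp hZ)
  rw [zero_mul, zero_add] at hφ
  refine tendsto_nhds_unique h1 ((hφ.mono_left nhdsWithin_le_nhds).congr' ?_)
  filter_upwards [nhdsWithin_le_nhds hmem, self_mem_nhdsWithin] with s hs hs0
  have hs0' : s ≠ 0 := hs0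
  simp only [zero_add, zero_smul, add_zero]
  rw [hJ _ hs, hJ _ h, hd _ hs, add_sub_cancel_left, toMatrix_smul, transpose_smul]
  simp only [add_mul, trace_add, smul_mul_assoc, trace_smul, smul_eq_mul, Matrix.smul_mul,
    Matrix.mul_smul]
  field_simp
  ring

end Smooth

/-! ### Bounds on sublevel sets -/

section Bounds

variable {n m : ℕ} {A : Matrix (Fin n) (Fin n) ℝ} {B : Matrix (Fin n) (Fin m) ℝ}
  {W Q : Matrix (Fin n) (Fin n) ℝ} {R : Matrix (Fin m) (Fin m) ℝ} {δ : Fin n → ℝ}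
  {θ : Policy n m}

lemma norm_sq_eq_sum (θ : Policy n m) : ‖θ‖ ^ 2 = ∑ i, θ.toMatrix i ⬝ᵥ θ.toMatrix i := by
  rw [EuclideanSpace.real_norm_sq_eq, Fintype.sum_prod_type]
  simp only [dotProduct, ← sq]
  rfl

lemma trace_statMoment_le (hR : R.PosSemidef) (hW : W.PosSemidef) {q a : ℝ}
    (hq : 0 < q) (hQq : (Q - q • (1 : Matrix (Fin n) (Fin n) ℝ)).PosSemidef)
    (h : θ ∈ stabilizing A B) (ha : statCost A B W Q R δ θ ≤ a) :
    trace (statMoment A B W θ) ≤ 1 + 2 * a / q + 2 * ∑ i, δ i ^ 2 := by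
  have hZ := posSemidef_statMoment (W := W) hW h
  set Z := statMoment A B W θ with hZdef
  have hZe : Z (Sum.inr ()) (Sum.inr ()) = 1 := statMoment_inr h
  have h1 : q * trace (errorMat δ * Z * (errorMat δ)ᵀ) ≤ a := by
    refine (smul_trace_le_trace_mul hQq (posSemidef_conj hZ _)).trans (le_trans ?_ ha)
    rw [statCost, trace_stageWeight_mul]
    exact le_add_of_nonneg_right (trace_mul_nonneg hR (posSemidef_conj hZ _))
  have h2 : ∀ i, Z (Sum.inl i) (Sum.inl i) ≤
      2 * (errorMat δ * Z * (errorMat δ)ᵀ) i i + 2 * δ i ^ 2 := fun i => by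
    have h3 : (Pi.single (Sum.inl i) 1 : Fin n ⊕ Unit → ℝ) =
        errorMat δ i + Pi.single (Sum.inr ()) (δ i) := by
      ext (j | j)
      · simp [errorMat, Pi.single_apply, Matrix.one_apply, eq_comm]
      · simp [errorMat]
    have h4 := quadratic_add_le hZ (errorMat δ i) (Pi.single (Sum.inr ()) (δ i))
    rw [← h3, ← conj_apply_self] at h4
    simpa [hZe, sq] using h4
  have h5 : trace Z = ∑ i, Z (Sum.inl i) (Sum.inl i) + 1 := by
    simp [trace, hZe]
  have h6 := Finset.sum_le_sum fun i (_ : i ∈ Finset.univ) => h2 i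
  rw [Finset.sum_add_distrib, ← Finset.mul_sum, ← Finset.mul_sum] at h6
  have h7 : trace (errorMat δ * Z * (errorMat δ)ᵀ) ≤ a / q := by
    rw [le_div_iff₀ hq, mul_comm]
    exact h1
  have h8 : ∑ i, (errorMat δ * Z * (errorMat δ)ᵀ) i i = trace (errorMat δ * Z * (errorMat δ)ᵀ) :=
    rfl
  rw [h8] at h6
  rw [h5, mul_div_assoc]
  linarith

lemma dotProduct_le_statMoment (hW : W.PosSemidef) {ω c : ℝ} (hω : 0 < ω)
    (hWω : (W - ω • (1 : Matrix (Fin n) (Fin n) ℝ)).PosSemidef)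
    (h : θ ∈ stabilizing A B) (hc : trace (statMoment A B W θ) ≤ c) (y : Fin n ⊕ Unit → ℝ) :
    y ⬝ᵥ y ≤ (1 / ω + 2 + 2 * c / ω) * (y ⬝ᵥ (statMoment A B W θ *ᵥ y)) := by
  have hZ := posSemidef_statMoment (W := W) hW h
  have h1 := (quadratic_of_posSemidef_sub hWω _).trans (quadratic_noise_le_statMoment hW h y)
  have hZe := statMoment_inr (W := W) h
  set Z := statMoment A B W θ
  have hc0 : 0 ≤ c := hZ.trace_nonneg.trans hc
  set k : Fin n → ℝ := y ∘ Sum.inl with hk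
  set z : Fin n ⊕ Unit → ℝ := Sum.elim k 0 with hz
  have hzz : z ⬝ᵥ z = k ⬝ᵥ k := by simp [hz, dotProduct]
  have hyy : y ⬝ᵥ y = k ⬝ᵥ k + y (Sum.inr ()) ^ 2 := by simp [hk, dotProduct, sq]
  have h2 : k ⬝ᵥ k ≤ (1 / ω) * (y ⬝ᵥ (Z *ᵥ y)) := by
    rw [one_div, ← div_eq_inv_mul, le_div_iff₀ hω, mul_comm]
    exact h1
  have hkk : 0 ≤ k ⬝ᵥ k := Finset.sum_nonneg fun _ _ => mul_self_nonneg _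
  have h3 : z ⬝ᵥ (Z *ᵥ z) ≤ c * (k ⬝ᵥ k) := by
    refine (quadratic_le_trace hZ z).trans ?_
    rw [hzz]
    exact mul_le_mul_of_nonneg_right hc hkk
  have h4 : y (Sum.inr ()) ^ 2 ≤ 2 * (y ⬝ᵥ (Z *ᵥ y)) + 2 * (z ⬝ᵥ (Z *ᵥ z)) := by
    have h5 : (Pi.single (Sum.inr ()) (y (Sum.inr ())) : Fin n ⊕ Unit → ℝ) = y + -z := by
      ext (j | j) <;> simp [hz, hk]
    have h6 := quadratic_add_le hZ y (-z)
    rw [← h5] at h6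
    simpa [hZe, sq, mulVec_neg] using h6
  have h7 : c * (k ⬝ᵥ k) ≤ c * ((1 / ω) * (y ⬝ᵥ (Z *ᵥ y))) := mul_le_mul_of_nonneg_left h2 hc0
  have h8 : (1 / ω + 2 + 2 * c / ω) * (y ⬝ᵥ (Z *ᵥ y)) =
      (1 / ω) * (y ⬝ᵥ (Z *ᵥ y)) + 2 * (y ⬝ᵥ (Z *ᵥ y)) +
        2 * (c * ((1 / ω) * (y ⬝ᵥ (Z *ᵥ y)))) := by ring
  rw [h8, hyy]
  linarith

/-- Uniform bounds on a sublevel set of the cost. -/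
lemma exists_sublevel_bounds (hQ : Q.PosDef) (hR : R.PosDef) (hW : W.PosDef) (δ : Fin n → ℝ)
    (a : ℝ) : ∃ c ζ ρ : ℝ, 0 < c ∧ 0 < ζ ∧ ∀ θ ∈ stabilizing A B, statCost A B W Q R δ θ ≤ a →
      trace (statMoment A B W θ) ≤ c ∧ (∀ y, ζ * (y ⬝ᵥ y) ≤ y ⬝ᵥ (statMoment A B W θ *ᵥ y)) ∧
        ‖θ‖ ≤ ρ := by
  obtain ⟨q, hq, hQq⟩ := exists_posSemidef_sub_smul_one hQ
  obtain ⟨r, hr, hRr⟩ := exists_posSemidef_sub_smul_one hR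
  obtain ⟨ω, hω, hWω⟩ := exists_posSemidef_sub_smul_one hW
  set c : ℝ := 1 + 2 * |a| / q + 2 * ∑ i, δ i ^ 2 with hc
  have hc0 : 0 < c := by
    have : 0 ≤ ∑ i, δ i ^ 2 := Finset.sum_nonneg fun _ _ => sq_nonneg _
    positivity
  set b : ℝ := 1 / ω + 2 + 2 * c / ω with hb
  have hb0 : 0 < b := by positivity
  refine ⟨c, 1 / b, Real.sqrt (|a| / r * b), hc0, by positivity, fun θ h ha => ?_⟩
  have ha' : statCost A B W Q R δ θ ≤ |a| := ha.trans (le_abs_self a)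
  have h1 := trace_statMoment_le hR.posSemidef hW.posSemidef hq hQq h ha'
  have h2 := dotProduct_le_statMoment hW.posSemidef hω hWω h h1
  refine ⟨h1, fun y => ?_, Real.le_sqrt_of_sq_le ?_⟩
  · rw [one_div, ← div_eq_inv_mul, div_le_iff₀ hb0, mul_comm]
    exact h2 y
  · have hZ := posSemidef_statMoment (W := W) hW.posSemidef h
    have h3 : r * trace (θ.toMatrix * statMoment A B W θ * θ.toMatrixᵀ) ≤ |a| := by
      refine (smul_trace_le_trace_mul hRr (posSemidef_conj hZ _)).trans (le_trans ?_ ha')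
      rw [statCost, trace_stageWeight_mul]
      exact le_add_of_nonneg_left (trace_mul_nonneg hQ.posSemidef (posSemidef_conj hZ _))
    have h4 : trace (θ.toMatrix * statMoment A B W θ * θ.toMatrixᵀ) ≤ |a| / r := by
      rw [le_div_iff₀ hr, mul_comm]
      exact h3
    rw [norm_sq_eq_sum, mul_comm]
    refine le_trans ?_ (mul_le_mul_of_nonneg_left h4 hb0.le)
    rw [trace, Finset.mul_sum]
    refine Finset.sum_le_sum fun i _ => ?_
    rw [diag_apply, conj_apply_self]
    exact h2 _

end Bounds

/-! ### Gradient domination -/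

section GradientDomination

variable {n m : ℕ} {A : Matrix (Fin n) (Fin n) ℝ} {B : Matrix (Fin n) (Fin m) ℝ}
  {W Q : Matrix (Fin n) (Fin n) ℝ} {R : Matrix (Fin m) (Fin m) ℝ} {δ : Fin n → ℝ}
  {θ θ' : Policy n m}

lemma trace_mul_le_trace_mul_trace {ι : Type*} [Fintype ι] [DecidableEq ι] {X Y : Matrix ι ι ℝ}
    (hX : X.PosSemidef) (hY : Y.PosSemidef) : trace (X * Y) ≤ trace X * trace Y := by
  have h : (trace X • (1 : Matrix ι ι ℝ) - X).PosSemidef := by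
    refine posSemidef_of_quadratic_nonneg (by simp [transpose_eq_of_posSemidef hX]) fun y => ?_
    rw [sub_mulVec, dotProduct_sub, smul_mulVec, one_mulVec, dotProduct_smul, smul_eq_mul,
      sub_nonneg]
    exact quadratic_le_trace hX y
  have := trace_mul_nonneg h hY
  rwa [sub_mul, trace_sub, smul_mul_assoc, one_mul, trace_smul, smul_eq_mul, sub_nonneg] at this

lemma sq_mul_dotProduct_le {ι : Type*} [Fintype ι] {Z : Matrix ι ι ℝ} {ζ : ℝ} (hζ : 0 < ζ)
    (hZ : ∀ y, ζ * (y ⬝ᵥ y) ≤ y ⬝ᵥ (Z *ᵥ y)) (y : ι → ℝ) :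
    ζ ^ 2 * (y ⬝ᵥ y) ≤ (Z *ᵥ y) ⬝ᵥ (Z *ᵥ y) := by
  have h0 : 0 ≤ y ⬝ᵥ y := Finset.sum_nonneg fun _ _ => mul_self_nonneg _
  rcases h0.eq_or_lt with h | h
  · rw [← h, mul_zero]
    exact Finset.sum_nonneg fun _ _ => mul_self_nonneg _
  · have h1 : (y ⬝ᵥ (Z *ᵥ y)) ^ 2 ≤ (y ⬝ᵥ y) * ((Z *ᵥ y) ⬝ᵥ (Z *ᵥ y)) := by
      simpa only [dotProduct, sq] using Finset.sum_mul_sq_le_sq_mul_sq Finset.univ y (Z *ᵥ y)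
    have h2 : (ζ * (y ⬝ᵥ y)) ^ 2 ≤ (y ⬝ᵥ (Z *ᵥ y)) ^ 2 :=
      pow_le_pow_left₀ (by positivity) (hZ y) 2
    refine le_of_mul_le_mul_left ?_ h
    calc (y ⬝ᵥ y) * (ζ ^ 2 * (y ⬝ᵥ y)) = (ζ * (y ⬝ᵥ y)) ^ 2 := by ring
      _ ≤ _ := h2.trans h1

lemma trace_transpose_mul_eq_sum {k : ℕ} {ι : Type*} [Fintype ι] (X Y : Matrix (Fin k) ι ℝ) :
    trace (Xᵀ * Y) = ∑ i, X i ⬝ᵥ Y i := by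
  simp only [trace, diag, mul_apply, transpose_apply, dotProduct]
  exact Finset.sum_comm

/-- The minimum of the quadratic expression in the performance difference formula. -/
lemma neg_trace_le_trace_quadratic {k : ℕ} {ι : Type*} [Fintype ι] [DecidableEq ι] {r : ℝ}
    (hr : 0 < r) {G : Matrix (Fin k) (Fin k) ℝ}
    (hG : (G - r • (1 : Matrix (Fin k) (Fin k) ℝ)).PosSemidef) (E Δ : Matrix (Fin k) ι ℝ)
    {Z : Matrix ι ι ℝ} (hZ : Z.PosSemidef) :
    -(r⁻¹ * trace (Eᵀ * E * Z)) ≤ trace ((Δᵀ * G * Δ + Δᵀ * E + Eᵀ * Δ) * Z) := by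
  have h1 : (Δᵀ * G * Δ + Δᵀ * E + Eᵀ * Δ) + r⁻¹ • (Eᵀ * E) =
      Δᵀ * (G - r • (1 : Matrix (Fin k) (Fin k) ℝ)) * Δ +
        r • ((Δ + r⁻¹ • E)ᵀ * (Δ + r⁻¹ • E)) := by
    simp only [transpose_add, transpose_smul, Matrix.mul_add, Matrix.add_mul, Matrix.mul_sub,
      Matrix.sub_mul, smul_add, Matrix.mul_smul, Matrix.smul_mul, Matrix.mul_one, smul_smul,
      mul_inv_cancel₀ hr.ne', mul_inv_cancel_left₀ hr.ne', one_smul]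
    abel
  have h2 : (Δᵀ * (G - r • (1 : Matrix (Fin k) (Fin k) ℝ)) * Δ +
        r • ((Δ + r⁻¹ • E)ᵀ * (Δ + r⁻¹ • E))).PosSemidef := by
    refine (posSemidef_conj' hG Δ).add (PosSemidef.smul ?_ hr.le)
    simpa using posSemidef_conjTranspose_mul_self (Δ + r⁻¹ • E)
  have h3 := trace_mul_nonneg h2 hZ
  rw [← h1, add_mul, trace_add, smul_mul_assoc, trace_smul, smul_eq_mul] at h3
  linarith

/-- Gradient domination between two policies of a sublevel set. -/
lemma exists_gradient_domination (hQ : Q.PosDef) (hR : R.PosDef) (hW : W.PosDef) {J : Policy n m → ℝ}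
    (hJ : ∀ ϑ ∈ stabilizing A B, J ϑ = statCost A B W Q R δ ϑ) (a : ℝ) :
    ∃ lam : ℝ, 0 < lam ∧ ∀ θ ∈ stabilizing A B, ∀ θ' ∈ stabilizing A B, J θ ≤ a → J θ' ≤ a →
      J θ - J θ' ≤ lam * ‖gradient J θ‖ ^ 2 := by
  obtain ⟨c, ζ, ρ, hc, hζ, hbound⟩ := exists_sublevel_bounds (A := A) (B := B) hQ hR hW δ a
  obtain ⟨r, hr, hRr⟩ := exists_posSemidef_sub_smul_one hR
  refine ⟨r⁻¹ * (c * ((ζ ^ 2)⁻¹ * (1 / 4))), by positivity, fun θ h θ' h' ha ha' => ?_⟩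
  obtain ⟨-, hZ, -⟩ := hbound θ h ((hJ θ h) ▸ ha)
  obtain ⟨hZ', -, -⟩ := hbound θ' h' ((hJ θ' h') ▸ ha')
  obtain ⟨G, E, hG, hd⟩ := exists_performance_difference (W := W) (δ := δ) hQ.posSemidef
    hR.posSemidef h
  have hGr : (G - r • (1 : Matrix (Fin m) (Fin m) ℝ)).PosSemidef := by
    have := hG.add hRr
    rwa [sub_add_sub_cancel] at this
  have hZp := posSemidef_statMoment (W := W) hW.posSemidef h
  have hZp' := posSemidef_statMoment (W := W) hW.posSemidef h'
  have hEE : (Eᵀ * E).PosSemidef := by simpa using posSemidef_conjTranspose_mul_self E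
  -- the upper bound by the size of `E`
  have h1 : J θ - J θ' ≤ r⁻¹ * (c * trace (Eᵀ * E)) := by
    have h2 := neg_trace_le_trace_quadratic hr hGr E (θ' - θ).toMatrix hZp'
    rw [← hd θ' h', ← hJ _ h, ← hJ _ h'] at h2
    have h3 : trace (Eᵀ * E * statMoment A B W θ') ≤ c * trace (Eᵀ * E) := by
      refine (trace_mul_le_trace_mul_trace hEE hZp').trans ?_
      rw [mul_comm]
      exact mul_le_mul_of_nonneg_right hZ' hEE.trace_nonneg
    have h4 := mul_le_mul_of_nonneg_left h3 (inv_pos.2 hr).le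
    linarith
  -- the gradient is `2 E Z`
  set D : Policy n m := Policy.ofMatrix (E * statMoment A B W θ) with hD
  have hDm : D.toMatrix = E * statMoment A B W θ := rfl
  have hZt := transpose_eq_of_posSemidef hZp
  have h5 : ‖D‖ ^ 2 = trace (D.toMatrixᵀ * D.toMatrix) := by
    rw [norm_sq_eq_sum, trace_transpose_mul_eq_sum]
  have h6 : inner ℝ (gradient J θ) D = 2 * ‖D‖ ^ 2 := by
    rw [inner_gradient_eq_trace hJ h hd D, add_mul, trace_add, Matrix.mul_assoc, ← hDm, h5]
    have : trace (Eᵀ * D.toMatrix * statMoment A B W θ) = trace (D.toMatrixᵀ * D.toMatrix) := by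
      rw [Matrix.mul_assoc, trace_mul_comm, Matrix.mul_assoc, trace_mul_comm, ← hZt,
        ← transpose_mul, ← hDm]
    rw [this]
    ring
  have h7 : 2 * ‖D‖ ≤ ‖gradient J θ‖ := by
    rcases (norm_nonneg D).eq_or_lt with h0 | h0
    · rw [← h0, mul_zero]
      exact norm_nonneg _
    · have := real_inner_le_norm (gradient J θ) D
      rw [h6] at this
      nlinarith
  have h8 : ζ ^ 2 * trace (Eᵀ * E) ≤ ‖D‖ ^ 2 := by
    rw [norm_sq_eq_sum, trace_transpose_mul_eq_sum, Finset.mul_sum]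
    refine Finset.sum_le_sum fun i _ => ?_
    have : D.toMatrix i = statMoment A B W θ *ᵥ E i := by
      rw [hDm, ← hZt, mulVec_transpose, hZt]
      rfl
    rw [this]
    exact sq_mul_dotProduct_le hζ hZ (E i)
  have h9 : trace (Eᵀ * E) ≤ (ζ ^ 2)⁻¹ * (1 / 4) * ‖gradient J θ‖ ^ 2 := by
    rw [mul_assoc, ← div_eq_inv_mul, le_div_iff₀ (by positivity), mul_comm]
    have := pow_le_pow_left₀ (by positivity) h7 2
    linarith
  refine h1.trans ?_
  have h10 := mul_le_mul_of_nonneg_left (mul_le_mul_of_nonneg_left h9 hc.le) (inv_pos.2 hr).le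
  linarith

end GradientDomination

/-! ### Local smoothness -/

section LocalSmoothness

variable {n m : ℕ} {A : Matrix (Fin n) (Fin n) ℝ} {B : Matrix (Fin n) (Fin m) ℝ}
  {W Q : Matrix (Fin n) (Fin n) ℝ} {R : Matrix (Fin m) (Fin m) ℝ} {δ : Fin n → ℝ}

/-- A compact set of stabilizing policies. -/
def boundedCov (A : Matrix (Fin n) (Fin n) ℝ) (B : Matrix (Fin n) (Fin m) ℝ)
    (W : Matrix (Fin n) (Fin n) ℝ) (ρ c : ℝ) : Set (Policy n m) :=
  {θ | ‖θ‖ ≤ ρ ∧ ∀ k, traceCov A B W θ k ≤ c}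

lemma continuous_traceCov (k : ℕ) :
    Continuous fun θ : Policy n m => traceCov A B W θ k := by
  have hF : Continuous fun θ : Policy n m => A + B * θ.K :=
    continuous_const.add (continuous_const.matrix_mul continuous_K)
  refine continuous_finsetSum _ fun i _ => ?_
  exact (((hF.pow i).mul continuous_const).mul (hF.pow i).matrix_transpose).matrix_trace

lemma isCompact_boundedCov (ρ c : ℝ) : IsCompact (boundedCov A B W ρ c : Set (Policy n m)) := by
  have h : (boundedCov A B W ρ c : Set (Policy n m)) =
      Metric.closedBall 0 ρ ∩ ⋂ k, {θ | traceCov A B W θ k ≤ c} := by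
    ext θ
    simp [boundedCov]
  rw [h]
  exact (isCompact_closedBall 0 ρ).inter_right
    (isClosed_iInter fun k => isClosed_le (continuous_traceCov k) continuous_const)

lemma boundedCov_subset_stabilizing (hW : W.PosDef) (ρ c : ℝ) :
    (boundedCov A B W ρ c : Set (Policy n m)) ⊆ stabilizing A B :=
  fun _ h => mem_stabilizing_of_traceCov_le hW h.2

/-- Sublevel sets of the cost lie in a compact set of stabilizing policies. -/
lemma exists_sublevel_subset_boundedCov (hQ : Q.PosDef) (hR : R.PosDef) (hW : W.PosDef)
    {J : Policy n m → ℝ} (hJ : ∀ ϑ ∈ stabilizing A B, J ϑ = statCost A B W Q R δ ϑ) (a : ℝ) :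
    ∃ ρ c : ℝ, {θ | θ ∈ stabilizing A B ∧ J θ ≤ a} ⊆ boundedCov A B W ρ c := by
  obtain ⟨c, ζ, ρ, -, -, hbound⟩ := exists_sublevel_bounds (A := A) (B := B) hQ hR hW δ a
  refine ⟨ρ, c, fun θ hθ => ?_⟩
  obtain ⟨h1, -, h2⟩ := hbound θ hθ.1 ((hJ θ hθ.1) ▸ hθ.2)
  exact ⟨h2, fun k => (traceCov_le_trace_statMoment hW.posSemidef hθ.1 k).trans h1⟩

/-- A function that is twice continuously differentiable near a compact set satisfies the descent
inequality along the segments contained in that set. -/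
lemma exists_descent_of_isCompact {E : Type*} [NormedAddCommGroup E] [InnerProductSpace ℝ E]
    [CompleteSpace E] {f : E → ℝ} {C : Set E} (hC : IsCompact C)
    (hf : ∀ x ∈ C, ContDiffAt ℝ 2 f x) :
    ∃ L : ℝ, 0 < L ∧ ∀ x y : E, segment ℝ x y ⊆ C →
      f y ≤ f x + inner ℝ (gradient f x) (y - x) + L * ‖y - x‖ ^ 2 / 2 := by
  have hf1 : ∀ x ∈ C, ContDiffAt ℝ 1 (fderiv ℝ f) x := fun x hx =>
    (hf x hx).fderiv_right (m := 1) (by norm_num)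
  have hf2 : ContinuousOn (fun x => fderiv ℝ (fderiv ℝ f) x) C := fun x hx =>
    ((hf1 x hx).fderiv_right (m := 0) (by norm_num)).continuousAt.continuousWithinAt
  obtain ⟨L, hL⟩ := hC.exists_bound_of_continuousOn (f := fun x => fderiv ℝ (fderiv ℝ f) x) hf2
  refine ⟨2 * (|L| + 1), by positivity, fun x y hxy => ?_⟩
  have hL' : ∀ z ∈ segment ℝ x y, ‖fderiv ℝ (fderiv ℝ f) z‖ ≤ |L| + 1 := fun z hz =>
    (hL z (hxy hz)).trans ((le_abs_self L).trans (by linarith))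
  have hxs : x ∈ segment ℝ x y := left_mem_segment ℝ x y
  have hys : y ∈ segment ℝ x y := right_mem_segment ℝ x y
  have hdist : ∀ z ∈ segment ℝ x y, ‖z - x‖ ≤ ‖y - x‖ := fun z hz => by
    rw [segment_eq_image'] at hz
    obtain ⟨t, ht, rfl⟩ := hz
    rw [add_sub_cancel_left, norm_smul, Real.norm_of_nonneg ht.1]
    exact mul_le_of_le_one_left (norm_nonneg _) ht.2
  have h1 : ∀ z ∈ segment ℝ x y, ‖fderiv ℝ f z - fderiv ℝ f x‖ ≤ (|L| + 1) * ‖y - x‖ :=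
    fun z hz => by
    have := (convex_segment x y).norm_image_sub_le_of_norm_hasFDerivWithin_le (𝕜 := ℝ)
      (f := fderiv ℝ f) (f' := fun z => fderiv ℝ (fderiv ℝ f) z)
      (fun z hz => ((hf1 z (hxy hz)).differentiableAt
        one_ne_zero).hasFDerivAt.hasFDerivWithinAt) hL' hxs hz
    exact this.trans (mul_le_mul_of_nonneg_left (hdist z hz) (by positivity))
  have hd : ∀ z ∈ segment ℝ x y, DifferentiableAt ℝ f z := fun z hz =>
    (hf z (hxy hz)).differentiableAt two_ne_zero
  have h2 := (convex_segment x y).norm_image_sub_le_of_norm_hasFDerivWithin_le' (𝕜 := ℝ)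
    (f := f) (f' := fun z => fderiv ℝ f z) (φ := fderiv ℝ f x)
    (fun z hz => (hd z hz).hasFDerivAt.hasFDerivWithinAt) h1 hxs hys
  have h3 : fderiv ℝ f x (y - x) = inner ℝ (gradient f x) (y - x) := by
    rw [(hd x hxs).hasGradientAt.hasFDerivAt.fderiv, InnerProductSpace.toDual_apply_apply]
  rw [h3] at h2
  have h4 := (Real.le_norm_self _).trans h2
  nlinarith

lemma exists_locallySmooth (hQ : Q.PosDef) (hR : R.PosDef) (hW : W.PosDef)
    {J : Policy n m → ℝ} (hJ : ∀ ϑ ∈ stabilizing A B, J ϑ = statCost A B W Q R δ ϑ) (a : ℝ) :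
    ∃ L : ℝ, 0 < L ∧ LocallySmooth J {θ | θ ∈ stabilizing A B ∧ J θ ≤ a} L := by
  obtain ⟨ρ, c, hsub⟩ := exists_sublevel_subset_boundedCov hQ hR hW hJ a
  obtain ⟨L, hL, h⟩ := exists_descent_of_isCompact (f := J) (isCompact_boundedCov ρ c)
    fun θ hθ => contDiffAt_of_eq_statCost hJ (boundedCov_subset_stabilizing hW ρ c hθ)
  refine ⟨L, hL, fun θ hθ θ' hθ' hφ => h θ θ' fun z hz => hsub ?_⟩
  rw [segment_eq_image'] at hz
  obtain ⟨t, ht, rfl⟩ := hz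
  rcases ht.1.eq_or_lt with h0 | h0
  · simpa [← h0] using hθ
  rcases ht.2.eq_or_lt with h1 | h1
  · simpa [h1] using hθ'
  exact hφ t ⟨h0, h1⟩

end LocalSmoothness

/-! ### The data matrices -/

section DataLemmas

variable {n m T : ℕ} {U₀ : Matrix (Fin m) (Fin T) ℝ} {X₀ X₁ : Matrix (Fin n) (Fin T) ℝ}
  {A : Matrix (Fin n) (Fin n) ℝ} {B : Matrix (Fin n) (Fin m) ℝ}

lemma isUnit_of_rank_eq_card {ι : Type*} [Fintype ι] [DecidableEq ι] {S : Matrix ι ι ℝ}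
    (h : S.rank = Fintype.card ι) : IsUnit S := by
  rw [← mulVec_surjective_iff_isUnit]
  have : LinearMap.range S.mulVecLin = ⊤ := by
    apply Submodule.eq_top_of_finrank_eq
    rw [Module.finrank_fintype_fun_eq_card]
    exact h
  exact LinearMap.range_eq_top.1 this

lemma isUnit_Lam (hD : (D₀ U₀ X₀).rank = m + n) : IsUnit (Lam U₀ X₀) := by
  have h1 : IsUnit (D₀ U₀ X₀ * (D₀ U₀ X₀)ᵀ) := by
    apply isUnit_of_rank_eq_card
    rw [rank_self_mul_transpose, hD]
    simp
  rcases Nat.eq_zero_or_pos T with hT | hT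
  · subst hT
    have h0 : m + n = 0 := by
      have := (D₀ U₀ X₀).rank_le_card_width
      simp at this
      omega
    have : m = 0 ∧ n = 0 := by omega
    obtain ⟨rfl, rfl⟩ := this
    exact isUnit_of_subsingleton _
  · rw [Lam]
    have hT' : (1 / (T : ℝ)) ≠ 0 := by positivity
    exact (isUnit_smul_iff (Units.mk0 _ hT') _).2 h1

lemma bar_eq_mul_Lam {k : ℕ} (C : Matrix (Fin k) (Fin m ⊕ Fin n) ℝ) :
    bar U₀ X₀ (C * D₀ U₀ X₀) = C * Lam U₀ X₀ := by
  rw [bar, Lam, Matrix.mul_smul, Matrix.mul_assoc]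

lemma bar_X₀ : bar U₀ X₀ X₀ = (fromCols 0 1 : Matrix (Fin n) (Fin m ⊕ Fin n) ℝ) * Lam U₀ X₀ := by
  rw [← bar_eq_mul_Lam]
  congr 1
  rw [D₀, fromCols_mul_fromRows]
  simp

/-- The residual of a least-squares fit is orthogonal to the data. -/
lemma IsLeastSquares.residual (h : IsLeastSquares U₀ X₀ X₁ A B) :
    (X₁ - A * X₀ - B * U₀) * X₀ᵀ = 0 ∧ (X₁ - A * X₀ - B * U₀) * U₀ᵀ = 0 := by
  set E := X₁ - A * X₀ - B * U₀ with hE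
  set Y := E * X₀ᵀ * X₀ + E * U₀ᵀ * U₀ with hY
  set p := ∑ i, ∑ j, E i j * Y i j with hp
  set s := ∑ i, ∑ j, Y i j ^ 2 with hs
  have hs0 : 0 ≤ s := Finset.sum_nonneg fun _ _ => Finset.sum_nonneg fun _ _ => sq_nonneg _
  have h1 : ∀ t : ℝ, 0 ≤ -2 * t * p + t ^ 2 * s := by
    intro t
    have h2 := h (A + t • (E * X₀ᵀ)) (B + t • (E * U₀ᵀ))
    have h3 : X₁ - (A + t • (E * X₀ᵀ)) * X₀ - (B + t • (E * U₀ᵀ)) * U₀ = E - t • Y := by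
      rw [hY, hE]
      simp only [Matrix.add_mul, Matrix.smul_mul, smul_add]
      abel
    rw [h3, ← hE] at h2
    have h4 : ∑ i, ∑ j, (E - t • Y) i j ^ 2 =
        ∑ i, ∑ j, E i j ^ 2 + (-2 * t * p + t ^ 2 * s) := by
      rw [hp, hs]
      simp only [Finset.mul_sum, ← Finset.sum_add_distrib]
      refine Finset.sum_congr rfl fun i _ => Finset.sum_congr rfl fun j _ => ?_
      rw [Matrix.sub_apply, Matrix.smul_apply, smul_eq_mul]
      ring
    linarith
  have hp0 : p = 0 := by
    have h2 := h1 (p / (s + 1))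
    have hs1 : 0 < s + 1 := by linarith
    have h3 : -2 * (p / (s + 1)) * p + (p / (s + 1)) ^ 2 * s =
        -(p ^ 2 * (s + 2)) / (s + 1) ^ 2 := by
      field_simp
      ring
    rw [h3, le_div_iff₀ (by positivity), zero_mul] at h2
    have h4 : p ^ 2 ≤ 0 := by nlinarith [sq_nonneg p]
    exact pow_eq_zero_iff two_ne_zero |>.1 (le_antisymm h4 (sq_nonneg p))
  have hpt : p = trace ((E * X₀ᵀ) * (E * X₀ᵀ)ᵀ) + trace ((E * U₀ᵀ) * (E * U₀ᵀ)ᵀ) := by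
    have h2 : p = trace (Eᵀ * Y) := by
      rw [trace_transpose_mul_eq_sum]
      rfl
    have h3 : ∀ {k : ℕ} (X : Matrix (Fin k) (Fin T) ℝ),
        trace (Eᵀ * (E * Xᵀ * X)) = trace ((E * Xᵀ) * (E * Xᵀ)ᵀ) := fun X => by
      rw [transpose_mul, transpose_transpose, trace_mul_comm, Matrix.mul_assoc (E * Xᵀ)]
    rw [h2, hY, Matrix.mul_add, trace_add, h3, h3]
  have hnn : ∀ {k : ℕ} (X : Matrix (Fin n) (Fin k) ℝ), 0 ≤ trace (X * Xᵀ) := fun X => by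
    have := (posSemidef_self_mul_conjTranspose X).trace_nonneg
    rwa [conjTranspose_eq_transpose_of_trivial] at this
  have hz : ∀ {k : ℕ} {X : Matrix (Fin n) (Fin k) ℝ}, trace (X * Xᵀ) = 0 → X = 0 := fun hX => by
    rw [← conjTranspose_eq_transpose_of_trivial] at hX
    exact trace_mul_conjTranspose_self_eq_zero_iff.1 hX
  have n1 := hnn (E * X₀ᵀ)
  have n2 := hnn (E * U₀ᵀ)
  exact ⟨hz (by linarith), hz (by linarith)⟩

lemma IsLeastSquares.bar_X₁ (h : IsLeastSquares U₀ X₀ X₁ A B) :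
    bar U₀ X₀ X₁ = fromCols B A * Lam U₀ X₀ := by
  rw [← bar_eq_mul_Lam, bar, bar]
  congr 1
  rw [D₀, fromCols_mul_fromRows, ← sub_eq_zero, ← Matrix.sub_mul, transpose_fromRows, mul_fromCols]
  have h1 : X₁ - (B * U₀ + A * X₀) = X₁ - A * X₀ - B * U₀ := by abel
  rw [h1, h.residual.1, h.residual.2, fromCols_zero]

/-- The feasible policies are the policies that stabilize the least-squares model. -/
lemma policySet_eq_stabilizing (hD : (D₀ U₀ X₀).rank = m + n)
    (h : IsLeastSquares U₀ X₀ X₁ A B) : policySet U₀ X₀ X₁ = stabilizing A B := by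
  have hcl : ∀ (K : Matrix (Fin m) (Fin n) ℝ) (V : Matrix (Fin m ⊕ Fin n) (Fin n) ℝ),
      fromRows K 1 = Lam U₀ X₀ * V → bar U₀ X₀ X₁ * V = A + B * K := fun K V hV => by
    rw [h.bar_X₁, Matrix.mul_assoc, ← hV, fromCols_mul_fromRows, Matrix.mul_one, add_comm]
  ext θ
  constructor
  · rintro ⟨ξ, ⟨-, -, hρ⟩, hK, -⟩
    rw [hcl _ _ hK, specRadius_lt_one_iff] at hρ
    exact hρ
  · intro hθ
    have hu := (isUnit_iff_isUnit_det _).1 (isUnit_Lam hD)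
    set KI : Matrix (Fin m ⊕ Fin n) (Fin n) ℝ := fromRows θ.K 1 with hKI
    have hV : KI = Lam U₀ X₀ * ((Lam U₀ X₀)⁻¹ * KI) := by
      rw [← Matrix.mul_assoc, mul_nonsing_inv _ hu, Matrix.one_mul]
    have hh : Sum.elim θ.l 0 = Lam U₀ X₀ *ᵥ ((Lam U₀ X₀)⁻¹ *ᵥ Sum.elim θ.l 0) := by
      rw [mulVec_mulVec, mul_nonsing_inv _ hu, one_mulVec]
    refine ⟨((Lam U₀ X₀)⁻¹ * KI, (Lam U₀ X₀)⁻¹ *ᵥ Sum.elim θ.l 0),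
      ⟨?_, ?_, ?_⟩, hV, hh⟩
    · rw [bar_X₀, Matrix.mul_assoc, ← hV, hKI, fromCols_mul_fromRows]
      simp
    · rw [bar_X₀, ← mulVec_mulVec, ← hh]
      ext i
      simp [fromCols_mulVec]
    · rw [hcl _ _ hV, specRadius_lt_one_iff]
      exact hθ

lemma posSemidef_precond (U₀ : Matrix (Fin m) (Fin T) ℝ) (X₀ : Matrix (Fin n) (Fin T) ℝ) :
    (precond U₀ X₀).PosSemidef := by
  set X := bar U₀ X₀ X₀ with hX
  set N := Xᵀ * (X * Xᵀ)⁻¹ * X with hN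
  have hS : ((X * Xᵀ)⁻¹)ᵀ = (X * Xᵀ)⁻¹ := by
    rw [transpose_nonsing_inv, transpose_mul, transpose_transpose]
  have hNt : Nᵀ = N := by
    rw [hN, transpose_mul, transpose_mul, transpose_transpose, hS, Matrix.mul_assoc]
  have hNN : N * N = N := by
    by_cases hu : IsUnit (X * Xᵀ).det
    · calc N * N = Xᵀ * ((X * Xᵀ)⁻¹ * (X * Xᵀ)) * (X * Xᵀ)⁻¹ * X := by
            simp only [hN, Matrix.mul_assoc]
        _ = N := by rw [nonsing_inv_mul _ hu, Matrix.mul_one]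
    · rw [hN, nonsing_inv_apply_not_isUnit _ hu]
      simp
  have hP : (1 - N).PosSemidef := by
    have h1 : (1 - N)ᵀ * (1 - N) = 1 - N := by
      rw [transpose_sub, transpose_one, hNt, Matrix.mul_sub, Matrix.sub_mul, Matrix.sub_mul, hNN]
      simp
    rw [← h1]
    have h2 := posSemidef_conjTranspose_mul_self (1 - N)
    rwa [conjTranspose_eq_transpose_of_trivial] at h2
  exact posSemidef_conj hP (bar U₀ X₀ U₀)

end DataLemmas

/-! ### Spectral norm and minimal singular value of a positive semidefinite matrix -/

section Singular

variable {m : ℕ} {M : Matrix (Fin m) (Fin m) ℝ}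

lemma quadratic_le_opNorm (M : Matrix (Fin m) (Fin m) ℝ) (v : Fin m → ℝ) :
    v ⬝ᵥ (M *ᵥ v) ≤ opNorm M * (v ⬝ᵥ v) := by
  set x : EuclideanSpace ℝ (Fin m) := WithLp.toLp 2 v
  have h1 : inner ℝ x (toEuclideanCLM (𝕜 := ℝ) M x) = v ⬝ᵥ (M *ᵥ v) := by
    rw [inner_toEuclideanCLM]
  have h2 : v ⬝ᵥ v = ‖x‖ ^ 2 := by
    rw [EuclideanSpace.real_norm_sq_eq]
    simp [dotProduct, x, sq]
  rw [← h1, h2]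
  refine (real_inner_le_norm _ _).trans ?_
  have h3 := (toEuclideanCLM (𝕜 := ℝ) M).le_opNorm x
  calc ‖x‖ * ‖toEuclideanCLM (𝕜 := ℝ) M x‖ ≤ ‖x‖ * (opNorm M * ‖x‖) :=
        mul_le_mul_of_nonneg_left h3 (norm_nonneg _)
    _ = _ := by ring

lemma opNorm_nonneg (M : Matrix (Fin m) (Fin m) ℝ) : 0 ≤ opNorm M := norm_nonneg _

lemma posSemidef_opNorm_smul_sub_mul_self (hM : M.PosSemidef) :
    (opNorm M • M - M * M).PosSemidef := by
  have ht := transpose_eq_of_posSemidef hM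
  refine posSemidef_of_quadratic_nonneg (by simp [ht]) fun v => ?_
  rw [sub_mulVec, dotProduct_sub, smul_mulVec, dotProduct_smul, smul_eq_mul, sub_nonneg]
  have h0 : v ⬝ᵥ (M * M) *ᵥ v = (M *ᵥ v) ⬝ᵥ (M *ᵥ v) := by
    rw [← mulVec_mulVec, dotProduct_mulVec, ← mulVec_transpose, ht]
  rw [h0]
  set u := M *ᵥ v with hu
  have hvM : 0 ≤ v ⬝ᵥ u := quadratic_nonneg hM v
  have hnn : 0 ≤ u ⬝ᵥ u := Finset.sum_nonneg fun _ _ => mul_self_nonneg _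
  obtain ⟨C, hC⟩ := exists_eq_transpose_mul_self hM
  have hbil : ∀ x y : Fin m → ℝ, x ⬝ᵥ (M *ᵥ y) = (C *ᵥ x) ⬝ᵥ (C *ᵥ y) := fun x y => by
    rw [hC, ← mulVec_mulVec, dotProduct_mulVec, vecMul_transpose]
  have hcs : (u ⬝ᵥ u) ^ 2 ≤ (u ⬝ᵥ (M *ᵥ u)) * (v ⬝ᵥ u) := by
    have h1 : u ⬝ᵥ u = (C *ᵥ u) ⬝ᵥ (C *ᵥ v) := by
      nth_rewrite 2 [hu]
      exact hbil u v
    have h2 : v ⬝ᵥ u = (C *ᵥ v) ⬝ᵥ (C *ᵥ v) := hbil v v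
    rw [h1, h2, hbil u u]
    simpa only [dotProduct, sq] using
      Finset.sum_mul_sq_le_sq_mul_sq Finset.univ (C *ᵥ u) (C *ᵥ v)
  have h3 : (u ⬝ᵥ u) ^ 2 ≤ (opNorm M * (u ⬝ᵥ u)) * (v ⬝ᵥ u) :=
    hcs.trans (mul_le_mul_of_nonneg_right (quadratic_le_opNorm M u) hvM)
  rcases hnn.eq_or_lt with h | h
  · rw [← h]
    exact mul_nonneg (opNorm_nonneg M) hvM
  · refine le_of_mul_le_mul_left ?_ h
    linarith [h3]

lemma posSemidef_sub_minSingularValue (hM : M.PosSemidef) :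
    (M - minSingularValue M • (1 : Matrix (Fin m) (Fin m) ℝ)).PosSemidef := by
  set σ := minSingularValue M with hσ
  have hσ0 : 0 ≤ σ := LinearMap.singularValues_nonneg _ _
  have hH : (M - σ • (1 : Matrix (Fin m) (Fin m) ℝ)).IsHermitian :=
    hM.1.sub (by simp [IsHermitian])
  rw [hH.posSemidef_iff_eigenvalues_nonneg]
  intro i
  set ν := hH.eigenvalues i with hν
  set v := hH.eigenvectorBasis i with hv
  have hv0 : v.ofLp ≠ 0 := by
    intro h
    have : v = 0 := by ext j; simp [h]
    exact hH.eigenvectorBasis.orthonormal.ne_zero i this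
  have h1 : M *ᵥ v.ofLp = (ν + σ) • v.ofLp := by
    have := hH.mulVec_eigenvectorBasis i
    rw [sub_mulVec, smul_mulVec, one_mulVec, sub_eq_iff_eq_add] at this
    rw [add_smul]
    exact this
  have hvv : 0 < v.ofLp ⬝ᵥ v.ofLp := by
    have h0 : 0 ≤ v.ofLp ⬝ᵥ v.ofLp := Finset.sum_nonneg fun _ _ => mul_self_nonneg _
    exact lt_of_le_of_ne h0 fun h => hv0 (dotProduct_self_eq_zero.1 h.symm)
  have hμ : 0 ≤ ν + σ := by
    have := quadratic_nonneg hM v.ofLp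
    rw [h1, dotProduct_smul, smul_eq_mul] at this
    exact nonneg_of_mul_nonneg_left this hvv
  have hT : toEuclideanLin M v = (ν + σ) • v := by
    rw [toLpLin_apply, h1]
    rfl
  have hadj : (toEuclideanLin M).adjoint = toEuclideanLin M := by
    rw [← toEuclideanLin_conjTranspose_eq_adjoint, hM.1]
  have heig : Module.End.HasEigenvalue ((toEuclideanLin M).adjoint ∘ₗ toEuclideanLin M)
      ((ν + σ) ^ 2) := by
    refine Module.End.hasEigenvalue_of_hasEigenvector (x := v)
      ⟨Module.End.mem_eigenspace_iff.2 ?_, fun h => hv0 (by simp [h])⟩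
    rw [hadj, LinearMap.comp_apply, hT, map_smul, hT, smul_smul, sq]
  have hfin : Module.finrank ℝ (EuclideanSpace ℝ (Fin m)) = m := by simp
  obtain ⟨j, hj⟩ := (toEuclideanLin M).isSymmetric_adjoint_comp_self.exists_eigenvalues_eq hfin heig
  have hm : m - 1 < m := by have := j.2; omega
  have h2 : σ ^ 2 ≤ (ν + σ) ^ 2 := by
    have h3 : σ ^ 2 = _ := (toEuclideanLin M).sq_singularValues_of_lt hfin hm
    have h4 := (toEuclideanLin M).isSymmetric_adjoint_comp_self.eigenvalues_antitone hfin
      (show j ≤ ⟨m - 1, hm⟩ from Nat.le_sub_one_of_lt j.2)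
    rw [h3]
    refine h4.trans (le_of_eq ?_)
    simpa using hj
  have h5 := abs_le_of_sq_le_sq' h2 hμ
  change 0 ≤ ν
  linarith [h5.2]

end Singular

/-! ### Descent along segments that stay in a sublevel set -/

section Descent

variable {E : Type*} [NormedAddCommGroup E] [InnerProductSpace ℝ E] [CompleteSpace E]

lemma eventually_lt_of_inner_gradient_neg {f : E → ℝ} {x v : E} (hf : DifferentiableAt ℝ f x)
    (hv : inner ℝ (gradient f x) v < 0) : ∀ᶠ s : ℝ in 𝓝[>] 0, f (x + s • v) < f x := by
  have h1 : HasDerivAt (fun s : ℝ => f (x + s • v)) (inner ℝ (gradient f x) v) 0 := by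
    have hl : HasDerivAt (fun s : ℝ => x + s • v) v 0 := by
      simpa using ((hasDerivAt_id (0 : ℝ)).smul_const v).const_add x
    have hg : HasFDerivAt f (InnerProductSpace.toDual ℝ _ (gradient f x)) (x + (0 : ℝ) • v) := by
      simpa using hf.hasGradientAt.hasFDerivAt
    exact hg.comp_hasDerivAt 0 hl
  rw [hasDerivAt_iff_tendsto_slope_zero] at h1
  have h2 := (h1.mono_left (nhdsGT_le_nhdsNE 0)).eventually_lt_const hv
  filter_upwards [h2, self_mem_nhdsWithin] with s hs hs0
  have hs0' : (0 : ℝ) < s := hs0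
  simp only [zero_add, zero_smul, add_zero, smul_eq_mul] at hs
  have := neg_of_mul_neg_right hs (inv_nonneg.2 hs0'.le)
  linarith

/-- A sufficiently short step in a descent direction stays in the sublevel set. -/
lemma descent_step {f : E → ℝ} {U : Set E} {a L : ℝ} (hU : IsOpen U)
    (hf : ∀ x ∈ U, DifferentiableAt ℝ f x) (hS : IsClosed {x | x ∈ U ∧ f x ≤ a}) (hL : 0 < L)
    (hsm : ∀ x ∈ {x | x ∈ U ∧ f x ≤ a}, ∀ y ∈ {x | x ∈ U ∧ f x ≤ a},
      (∀ φ ∈ Set.Ioo (0 : ℝ) 1, x + φ • (y - x) ∈ {x | x ∈ U ∧ f x ≤ a}) →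
        f y ≤ f x + inner ℝ (gradient f x) (y - x) + L * ‖y - x‖ ^ 2 / 2)
    {x v : E} (hx : x ∈ {x | x ∈ U ∧ f x ≤ a}) (hv : L * ‖v‖ ^ 2 ≤ -inner ℝ (gradient f x) v) :
    x + v ∈ {x | x ∈ U ∧ f x ≤ a} ∧
      f (x + v) ≤ f x + inner ℝ (gradient f x) v + L * ‖v‖ ^ 2 / 2 := by
  set S := {x | x ∈ U ∧ f x ≤ a} with hSdef
  rcases eq_or_ne v 0 with rfl | hv0
  · simpa using hx
  have hvpos : 0 < ‖v‖ ^ 2 := by positivity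
  set g := inner ℝ (gradient f x) v with hg
  have hgneg : g < 0 := by
    have : 0 < L * ‖v‖ ^ 2 := by positivity
    linarith
  -- the smoothness inequality for an initial part of the segment
  have hpart : ∀ t : ℝ, 0 < t → (∀ ψ ∈ Set.Icc (0 : ℝ) t, x + ψ • v ∈ S) →
      f (x + t • v) ≤ f x + t * g + L * (t ^ 2 * ‖v‖ ^ 2) / 2 := by
    intro t ht h
    have h1 := hsm x hx (x + t • v) (h t ⟨ht.le, le_rfl⟩) fun φ hφ => by
      rw [add_sub_cancel_left, smul_smul]
      exact h _ ⟨by nlinarith [hφ.1], by nlinarith [hφ.2]⟩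
    rw [add_sub_cancel_left, inner_smul_right, norm_smul, mul_pow, Real.norm_eq_abs, sq_abs] at h1
    exact h1
  have hcont : Continuous fun t : ℝ => x + t • v := by fun_prop
  -- the segment stays in the sublevel set
  have hgood : Set.Icc (0 : ℝ) 1 ⊆ {t | ∀ ψ ∈ Set.Icc (0 : ℝ) t, x + ψ • v ∈ S} := by
    apply IsClosed.Icc_subset_of_forall_mem_nhdsWithin
    · apply isClosed_of_closure_subset
      intro t ht
      have htI : t ∈ Set.Icc (0 : ℝ) 1 :=
        closure_minimal Set.inter_subset_right isClosed_Icc ht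
      refine ⟨fun ψ hψ => ?_, htI⟩
      rcases hψ.2.eq_or_lt with h | h
      · rw [h]
        have hcl : IsClosed {t : ℝ | x + t • v ∈ S} := hS.preimage hcont
        refine closure_minimal (fun s hs => ?_) hcl ht
        exact hs.1 s ⟨hs.2.1, le_rfl⟩
      · obtain ⟨s, hs1, hs2⟩ := mem_closure_iff.1 ht (Set.Ioi ψ) isOpen_Ioi h
        exact hs2.1 ψ ⟨hψ.1, le_of_lt hs1⟩
    · intro ψ hψ
      have : ψ = 0 := le_antisymm hψ.2 hψ.1
      simpa [this] using hx
    · rintro t ⟨ht, ht0, ht1⟩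
      have hev : ∀ᶠ s in 𝓝[>] t, x + s • v ∈ S := by
        have hUt : ∀ᶠ s in 𝓝[>] t, x + s • v ∈ U :=
          nhdsWithin_le_nhds (hcont.continuousAt.eventually
            (hU.mem_nhds (ht t ⟨ht0, le_rfl⟩).1))
        have hft : ∀ᶠ s in 𝓝[>] t, f (x + s • v) < a := by
          rcases ht0.eq_or_lt with h | h
          · rw [← h]
            filter_upwards [eventually_lt_of_inner_gradient_neg (hf x hx.1) hgneg] with s hs
            exact hs.trans_le hx.2
          · have h1 := hpart t h ht
            have h2 : f (x + t • v) < a := by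
              have h3 : t * g + L * (t ^ 2 * ‖v‖ ^ 2) / 2 < 0 := by
                have h4 : L * (t ^ 2 * ‖v‖ ^ 2) ≤ t ^ 2 * -g := by
                  have := mul_le_mul_of_nonneg_left hv (sq_nonneg t)
                  linarith
                nlinarith [mul_pos h (neg_pos.2 hgneg)]
              linarith [hx.2]
            have hc : ContinuousAt (fun s : ℝ => f (x + s • v)) t :=
              ContinuousAt.comp (g := f) (hf _ (ht t ⟨ht0, le_rfl⟩).1).continuousAt
                hcont.continuousAt
            exact nhdsWithin_le_nhds (hc.eventually_lt_const h2)
        filter_upwards [hUt, hft] with s h1 h2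
        exact ⟨h1, h2.le⟩
      obtain ⟨u, hu, hsub⟩ := mem_nhdsGT_iff_exists_Ioo_subset.1 hev
      refine mem_nhdsGT_iff_exists_Ioo_subset.2 ⟨u, hu, fun s hs ψ hψ => ?_⟩
      rcases le_or_gt ψ t with h | h
      · exact ht ψ ⟨hψ.1, h⟩
      · exact hsub ⟨h, hψ.2.trans_lt hs.2⟩
  have h1 := hgood (Set.right_mem_Icc.2 zero_le_one)
  refine ⟨by simpa using h1 1 (Set.right_mem_Icc.2 zero_le_one), ?_⟩
  simpa using hpart 1 one_pos h1

end Descent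

section Iteration

variable {n m : ℕ} {A : Matrix (Fin n) (Fin n) ℝ} {B : Matrix (Fin n) (Fin m) ℝ}
  {W Q : Matrix (Fin n) (Fin n) ℝ} {R : Matrix (Fin m) (Fin m) ℝ} {δ : Fin n → ℝ}
  {J : Policy n m → ℝ}

lemma isClosed_sublevel (hQ : Q.PosDef) (hR : R.PosDef) (hW : W.PosDef)
    (hJ : ∀ ϑ ∈ stabilizing A B, J ϑ = statCost A B W Q R δ ϑ) (a : ℝ) :
    IsClosed {θ | θ ∈ stabilizing A B ∧ J θ ≤ a} := by
  obtain ⟨ρ, c, hsub⟩ := exists_sublevel_subset_boundedCov hQ hR hW hJ a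
  have hst := boundedCov_subset_stabilizing (A := A) (B := B) (m := m) hW ρ c
  have h : {θ | θ ∈ stabilizing A B ∧ J θ ≤ a} = boundedCov A B W ρ c ∩ J ⁻¹' Set.Iic a := by
    ext θ
    exact ⟨fun hθ => ⟨hsub hθ, hθ.2⟩, fun hθ => ⟨hst hθ.1, hθ.2⟩⟩
  rw [h]
  exact ContinuousOn.preimage_isClosed_of_isClosed
    (fun θ hθ => (contDiffAt_of_eq_statCost hJ (hst hθ) (k := 1)).continuousAt.continuousWithinAt)
    (isCompact_boundedCov ρ c).isClosed isClosed_Iic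

variable {M : Matrix (Fin m) (Fin m) ℝ}

lemma inner_eq_trace (θ θ' : Policy n m) :
    inner ℝ θ θ' = trace (θ.toMatrixᵀ * θ'.toMatrix) := by
  rw [trace_transpose_mul_eq_sum, PiLp.inner_apply, Fintype.sum_prod_type]
  simp only [dotProduct]
  refine Finset.sum_congr rfl fun i _ => Finset.sum_congr rfl fun j _ => ?_
  rw [real_inner_eq_re_inner, RCLike.inner_apply]
  simp [Policy.toMatrix, mul_comm]

lemma inner_precond_eq (M : Matrix (Fin m) (Fin m) ℝ) (D : Policy n m) :
    inner ℝ D (Policy.ofMatrix (M * D.toMatrix) : Policy n m) =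
      trace (M * (D.toMatrix * D.toMatrixᵀ)) := by
  rw [inner_eq_trace, trace_mul_comm]
  change trace (M * D.toMatrix * D.toMatrixᵀ) = _
  rw [Matrix.mul_assoc]

lemma posSemidef_mul_transpose (D : Policy n m) : (D.toMatrix * D.toMatrixᵀ).PosSemidef := by
  have := posSemidef_self_mul_conjTranspose D.toMatrix
  rwa [conjTranspose_eq_transpose_of_trivial] at this

lemma norm_precond_sq_le (hM : M.PosSemidef) (D : Policy n m) :
    ‖(Policy.ofMatrix (M * D.toMatrix) : Policy n m)‖ ^ 2 ≤
      opNorm M * trace (M * (D.toMatrix * D.toMatrixᵀ)) := by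
  have h := trace_mul_nonneg (posSemidef_opNorm_smul_sub_mul_self hM) (posSemidef_mul_transpose D)
  rw [sub_mul, trace_sub, smul_mul_assoc, trace_smul, smul_eq_mul, sub_nonneg] at h
  refine le_trans (le_of_eq ?_) h
  rw [← real_inner_self_eq_norm_sq, inner_eq_trace]
  change trace ((M * D.toMatrix)ᵀ * (M * D.toMatrix)) = _
  rw [transpose_mul, transpose_eq_of_posSemidef hM, Matrix.mul_assoc, trace_mul_comm]
  simp only [Matrix.mul_assoc]

lemma minSingularValue_mul_norm_sq_le (hM : M.PosSemidef) (D : Policy n m) :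
    minSingularValue M * ‖D‖ ^ 2 ≤ trace (M * (D.toMatrix * D.toMatrixᵀ)) := by
  have h := smul_trace_le_trace_mul (posSemidef_sub_minSingularValue hM)
    (posSemidef_mul_transpose D)
  rwa [trace_mul_comm D.toMatrix, ← inner_eq_trace, real_inner_self_eq_norm_sq] at h

/-- One preconditioned gradient step stays in the sublevel set and decreases the cost. -/
lemma step_mem_sublevel (hQ : Q.PosDef) (hR : R.PosDef) (hW : W.PosDef)
    (hJ : ∀ ϑ ∈ stabilizing A B, J ϑ = statCost A B W Q R δ ϑ) (hM : M.PosSemidef) {a L η : ℝ}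
    (hL : 0 < L) (hsm : LocallySmooth J {θ | θ ∈ stabilizing A B ∧ J θ ≤ a} L) (hη : 0 < η)
    (hη' : η ≤ 1 / (L * opNorm M)) {θ : Policy n m}
    (hθ : θ ∈ {θ | θ ∈ stabilizing A B ∧ J θ ≤ a}) :
    step M J η θ ∈ {θ | θ ∈ stabilizing A B ∧ J θ ≤ a} ∧
      J (step M J η θ) ≤ J θ - η * (1 - L * opNorm M * η / 2) *
        trace (M * ((gradient J θ).toMatrix * (gradient J θ).toMatrixᵀ)) := by
  set D := gradient J θ with hD
  set d : Policy n m := Policy.ofMatrix (M * D.toMatrix) with hd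
  set g := trace (M * (D.toMatrix * D.toMatrixᵀ)) with hg
  have hg0 : 0 ≤ g := trace_mul_nonneg hM (posSemidef_mul_transpose D)
  have hpos : 0 < L * opNorm M := by
    by_contra h
    have h1 : 1 / (L * opNorm M) ≤ 0 := one_div_nonpos.2 (not_lt.1 h)
    linarith
  have hη1 : η * (L * opNorm M) ≤ 1 := (le_div_iff₀ hpos).1 hη'
  have hinner : inner ℝ (gradient J θ) (-(η • d)) = -(η * g) := by
    rw [inner_neg_right, inner_smul_right, hd, ← hD, inner_precond_eq]
  have hnorm : ‖-(η • d)‖ ^ 2 ≤ η ^ 2 * (opNorm M * g) := by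
    rw [norm_neg, norm_smul, mul_pow, Real.norm_eq_abs, sq_abs]
    exact mul_le_mul_of_nonneg_left (norm_precond_sq_le hM D) (sq_nonneg η)
  have hLnorm : L * ‖-(η • d)‖ ^ 2 ≤ L * opNorm M * η ^ 2 * g := by
    have := mul_le_mul_of_nonneg_left hnorm hL.le
    linarith
  have hstep : step M J η θ = θ + -(η • d) := by rw [step, sub_eq_add_neg]
  rw [hstep]
  obtain ⟨h1, h2⟩ := descent_step isOpen_stabilizing
    (fun ϑ hϑ => (contDiffAt_of_eq_statCost hJ hϑ (k := 1)).differentiableAt one_ne_zero)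
    (isClosed_sublevel hQ hR hW hJ a) hL hsm hθ (v := -(η • d)) (by
      rw [hinner, neg_neg]
      refine hLnorm.trans ?_
      have := mul_le_mul_of_nonneg_right hη1 (mul_nonneg hη.le hg0)
      linarith)
  refine ⟨h1, h2.trans ?_⟩
  rw [hinner]
  linarith

end Iteration

end

end LQT

theorem lemma6 {n m T : ℕ} {Ω : Type*} [MeasurableSpace Ω]
    (P : MeasureTheory.Measure Ω) [MeasureTheory.IsProbabilityMeasure P]
    -- cost weights, set point, initial state
    (Q : Matrix (Fin n) (Fin n) ℝ) (R : Matrix (Fin m) (Fin m) ℝ) (hQ : Q.PosDef) (hR : R.PosDef)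
    (δ x₀ : Fin n → ℝ)
    -- independent Gaussian noise with covariance `W`
    (W : Matrix (Fin n) (Fin n) ℝ) (hW : W.PosDef)
    (w : ℕ → Ω → EuclideanSpace ℝ (Fin n))
    (hw_law : ∀ t, ProbabilityTheory.HasLaw (w t) (ProbabilityTheory.multivariateGaussian 0 W) P)
    (hw_indep : ProbabilityTheory.iIndepFun w P)
    -- persistently exciting data and the least-squares model
    (U₀ : Matrix (Fin m) (Fin T) ℝ) (X₀ X₁ : Matrix (Fin n) (Fin T) ℝ)
    (hD : (LQT.D₀ U₀ X₀).rank = m + n)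
    (A : Matrix (Fin n) (Fin n) ℝ) (B : Matrix (Fin n) (Fin m) ℝ)
    (hAB : LQT.IsLeastSquares U₀ X₀ X₁ A B)
    -- abbreviations: the cost, the optimal cost, the preconditioner
    (J : LQT.Policy n m → ℝ) (hJ : J = LQT.cost A B Q R δ x₀ P w)
    (Jstar : ℝ) (hJstar : Jstar = LQT.optimalCost A B Q R δ x₀ P w)
    (M : Matrix (Fin m) (Fin m) ℝ) (hM : M = LQT.precond U₀ X₀) :
    -- the cost is finite and differentiable on the feasible set
    (∀ θ ∈ LQT.policySet U₀ X₀ X₁, LQT.averageCost A B Q R δ x₀ P w θ ≠ ⊤ ∧ DifferentiableAt ℝ J θ) ∧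
    -- the constants exist on every sublevel set
    (∀ a : ℝ, Jstar ≤ a →
      (∃ lam : ℝ, 0 < lam ∧ LQT.GradientDominated J Jstar (LQT.sublevel U₀ X₀ X₁ J a) lam) ∧
      (∃ L : ℝ, 0 < L ∧ LQT.LocallySmooth J (LQT.sublevel U₀ X₀ X₁ J a) L)) ∧
    -- and with any such constants for the initial sublevel set the iteration converges linearly
    (∀ θ : ℕ → LQT.Policy n m, θ 0 ∈ LQT.policySet U₀ X₀ X₁ →
      ∀ lam : ℝ, 0 < lam → LQT.GradientDominated J Jstar (LQT.sublevel U₀ X₀ X₁ J (J (θ 0))) lam →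
      ∀ L : ℝ, 0 < L → LQT.LocallySmooth J (LQT.sublevel U₀ X₀ X₁ J (J (θ 0))) L →
      ∀ η : ℝ, 0 < η → η ≤ 1 / (L * LQT.opNorm M) →
      (∀ t, θ (t + 1) = LQT.step M J η (θ t)) →
      (∀ t, θ t ∈ LQT.sublevel U₀ X₀ X₁ J (J (θ 0))) ∧
      ∀ t, J (θ (t + 1)) - Jstar ≤
        (1 - η * (1 - L * LQT.opNorm M * η / 2) * LQT.minSingularValue M / lam) *
          (J (θ t) - Jstar)) := by
  have hset : LQT.policySet U₀ X₀ X₁ = LQT.stabilizing A B := LQT.policySet_eq_stabilizing hD hAB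
  have hsub : ∀ a, LQT.sublevel U₀ X₀ X₁ J a = {θ | θ ∈ LQT.stabilizing A B ∧ J θ ≤ a} := by
    intro a
    rw [LQT.sublevel, hset]
  have havg : ∀ θ ∈ LQT.stabilizing A B, LQT.averageCost A B Q R δ x₀ P w θ =
      ENNReal.ofReal (LQT.statCost A B W Q R δ θ) := fun θ hθ =>
    LQT.averageCost_eq_statCost x₀ hQ.posSemidef hR.posSemidef hW.posSemidef hw_law hw_indep hθ
  have hJ' : ∀ θ ∈ LQT.stabilizing A B, J θ = LQT.statCost A B W Q R δ θ := by
    intro θ hθ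
    rw [hJ, LQT.cost, havg θ hθ, ENNReal.toReal_ofReal
      (LQT.statCost_nonneg hQ.posSemidef hR.posSemidef hW.posSemidef hθ)]
  have hle : ∀ b : ℝ, ∀ θ ∈ LQT.stabilizing A B,
      (∀ θ' ∈ LQT.stabilizing A B, b ≤ J θ') → b ≤ Jstar := by
    intro b θ hθ hb
    have hinf : ENNReal.ofReal b ≤ ⨅ θ', LQT.averageCost A B Q R δ x₀ P w θ' := by
      refine le_iInf fun θ' => ?_
      by_cases htop : LQT.averageCost A B Q R δ x₀ P w θ' = ⊤
      · rw [htop]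
        exact le_top
      · have hθ' := LQT.mem_stabilizing_of_averageCost_ne_top x₀ hQ hR.posSemidef hW hw_law
          hw_indep htop
        rw [havg θ' hθ', ← hJ' θ' hθ']
        exact ENNReal.ofReal_le_ofReal (hb θ' hθ')
    have hfin : (⨅ θ', LQT.averageCost A B Q R δ x₀ P w θ') ≠ ⊤ := by
      refine ne_top_of_le_ne_top ?_ (iInf_le _ θ)
      rw [havg θ hθ]
      exact ENNReal.ofReal_ne_top
    rw [hJstar, LQT.optimalCost]
    exact (ENNReal.ofReal_le_iff_le_toReal hfin).1 hinf
  refine ⟨fun θ hθ => ?_, fun a _ => ⟨?_, ?_⟩, ?_⟩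
  · rw [hset] at hθ
    refine ⟨?_, (LQT.contDiffAt_of_eq_statCost hJ' hθ (k := 1)).differentiableAt one_ne_zero⟩
    rw [havg θ hθ]
    exact ENNReal.ofReal_ne_top
  · obtain ⟨lam, hlam, h⟩ := LQT.exists_gradient_domination hQ hR hW hJ' a
    refine ⟨lam, hlam, ?_⟩
    rw [hsub]
    rintro θ ⟨hθ, hθa⟩
    have := hle (J θ - lam * ‖gradient J θ‖ ^ 2) θ hθ fun θ' hθ' => ?_
    · linarith
    · rcases le_total (J θ') (J θ) with h' | h'
      · linarith [h θ hθ θ' hθ' hθa (h'.trans hθa)]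
      · have : 0 ≤ lam * ‖gradient J θ‖ ^ 2 := by positivity
        linarith
  · rw [hsub]
    exact LQT.exists_locallySmooth hQ hR hW hJ' a
  · intro θ hθ0 lam hlam hdom L hL hsm η hη hη' hstep
    rw [hset] at hθ0
    rw [hsub] at hdom hsm ⊢
    have hMp : M.PosSemidef := hM ▸ LQT.posSemidef_precond U₀ X₀
    have hmem : ∀ t, θ t ∈ {ϑ | ϑ ∈ LQT.stabilizing A B ∧ J ϑ ≤ J (θ 0)} := by
      intro t
      induction t with
      | zero => exact ⟨hθ0, le_rfl⟩
      | succ t ih =>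
        rw [hstep t]
        exact (LQT.step_mem_sublevel hQ hR hW hJ' hMp hL hsm hη hη' ih).1
    refine ⟨hmem, fun t => ?_⟩
    have hdec := (LQT.step_mem_sublevel hQ hR hW hJ' hMp hL hsm hη hη' (hmem t)).2
    rw [← hstep t] at hdec
    have hsv := LQT.minSingularValue_mul_norm_sq_le hMp (gradient J (θ t))
    have hsv0 : 0 ≤ LQT.minSingularValue M := LinearMap.singularValues_nonneg _ _
    have hpos : 0 < L * LQT.opNorm M := one_div_pos.1 (hη.trans_le hη')
    have hη1 : η * (L * LQT.opNorm M) ≤ 1 := (le_div_iff₀ hpos).1 hη'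
    have hcoef : 0 ≤ η * (1 - L * LQT.opNorm M * η / 2) :=
      mul_nonneg hη.le (by linarith)
    have hgap : (J (θ t) - Jstar) / lam ≤ ‖gradient J (θ t)‖ ^ 2 :=
      (div_le_iff₀' hlam).2 (hdom _ (hmem t))
    have hkey := mul_le_mul_of_nonneg_left
      ((mul_le_mul_of_nonneg_left hgap hsv0).trans hsv) hcoef
    calc J (θ (t + 1)) - Jstar
        ≤ J (θ t) - Jstar - η * (1 - L * LQT.opNorm M * η / 2) *
            (LQT.minSingularValue M * ((J (θ t) - Jstar) / lam)) := by linarith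
      _ = _ := by ring
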